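/- There are absolute constants $C, K > 0$ such that the following holds. Let $G=(X,Y;E)$ be a finite simple bipartite graph with $|X|=|Y|$ and $E\neq\emptyset$, and let $\varepsilon$ be a real number such that every vertex $v$ satisfies $(1-\varepsilon)|E|/|X| \le \deg(v) \le (1+\varepsilon)|E|/|X|$. For $S\subseteq V=X\cup Y$ let $\mathrm{vol}(S)=\sum_{v\in S}\deg(v)$, and let $$\phi(G)=\min_{S\subseteq V,\; 0<\mathrm{vol}(S)\le \mathrm{vol}(V)/2}\ \frac{|E(S,V\setminus S)|}{\mathrm{vol}(S)}$$ be the conductance of $G$. Assume $\phi(G)^4\ge C\,\varepsilon\ln|X|$. For a matrix $B\in\mathbb{R}_{\ge 0}^{X\times Y}$ write $s(B)$ for the sum of its entries and $r_i(B)$, $c_j(B)$ for its row and column sums; $B$ is called $\eta$-nearly doubly balanced if all $|X|\,r_i(B)$ and $|Y|\,c_j(B)$ lie in $[(1-\eta)s(B),(1+\eta)s(B)]$. Let $s_0>0$ and let $B^{(0)}$ be the $0/1$ biadjacency matrix of $G$ multiplied by $s_0/|E|$, so that $s(B^{(0)})=s_0$ (for $s_0=1$ the input is normalized to size one; for $s_0=|E|$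 it is the biadjacency matrix itself). The gradient flow with input $B^{(0)}$ is $$\frac{d}{dt}a_{ij}=\Big(\big(s(B)-|X|\,r_i(B)\big)+\big(s(B)-|Y|\,c_j(B)\big)\Big)a_{ij},\qquad B^{(t)}_{ij}=\big(a^{(t)}_{ij}\big)^2,\qquad a^{(0)}_{ij}=\sqrt{B^{(0)}_{ij}} .$$ Then the gradient flow exists for all $t\ge 0$, and for every solution, every $0<\eta\le 1$ and every $t\ge 0$ with $$ s_0\,\phi(G)^2\, t\ \ge\ K\,\ln|X|\,\ln(1/\eta) ,$$ the matrix $B^{(t)}$ is a scaling of the biadjacency matrix of $G$ (it equals $L\cdot B\cdot R$ with $B$ that matrix and $L,R$ diagonal with positive diagonal entries), it is $\eta$-nearly doubly balanced, and $\frac{|X|}{s(B^{(t)})}B^{(t)}$ is an $\eta$-nearly perfect fractional matching of $G$, i.e. a non-negative weighting of the edges of $G$ whose sum at every vertex lies in $[1-\eta,1+\eta]$. In particular, for $\phi(G)>0$ and $s_0\ge 1$, the flow reaches an $\eta$-nearly perfect fractional matching in time $O\big(\ln|X|\,\ln(1/\eta)/\phi(G)^2\big)$. -/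

import Mathlib

noncomputable section

namespace MatrixScaling

variable {X Y V : Type*} [Fintype X] [Fintype Y] [Fintype V]

/-- The size `s(B)` of a matrix: the sum of all its entries. -/
def size (B : Matrix X Y ℝ) : ℝ := ∑ i, ∑ j, B i j

/-- The `i`-th row sum `r_i(B)`. -/
def rowSum (B : Matrix X Y ℝ) (i : X) : ℝ := ∑ j, B i j

/-- The `j`-th column sum `c_j(B)`. -/
def colSum (B : Matrix X Y ℝ) (j : Y) : ℝ := ∑ i, B i j

/-- A non-negative `m × n` matrix is `η`-nearly doubly balanced if every row sum lies in
`[(1 - η) s / m, (1 + η) s / m]` and every column sum lies in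
`[(1 - η) s / n, (1 + η) s / n]`. -/
structure IsNearlyDoublyBalanced (η : ℝ) (B : Matrix X Y ℝ) : Prop where
  nonneg : ∀ i j, 0 ≤ B i j
  row_lower : ∀ i, (1 - η) * (size B / Fintype.card X) ≤ rowSum B i
  row_upper : ∀ i, rowSum B i ≤ (1 + η) * (size B / Fintype.card X)
  col_lower : ∀ j, (1 - η) * (size B / Fintype.card Y) ≤ colSum B j
  col_upper : ∀ j, colSum B j ≤ (1 + η) * (size B / Fintype.card Y)

/-- `B'` is a scaling of `B`: it is `L B R` for diagonal matrices `L`, `R` with positive diagonal. -/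
def IsScalingOf (B' B : Matrix X Y ℝ) : Prop :=
  ∃ (l : X → ℝ) (r : Y → ℝ), (∀ i, 0 < l i) ∧ (∀ j, 0 < r j) ∧
    ∀ i j, B' i j = l i * B i j * r j

/-- The entrywise square; `B = (a_ij ^ 2)` is the matrix being scaled when the state of the flow
is `a`. -/
def entrySq (a : Matrix X Y ℝ) : Matrix X Y ℝ := fun i j => a i j ^ 2

/-- The velocity of the flow at the state `a`: with `B = (a_ij ^ 2)`, its `(i, j)` entry is
`((s(B) - m r_i(B)) + (s(B) - n c_j(B))) a_ij`. This is `-1/4` times the gradient in `a` of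
`(1/m) ∑ i, (s(B) - m r_i(B))^2 + (1/n) ∑ j, (s(B) - n c_j(B))^2`. -/
def velocity (a : Matrix X Y ℝ) : Matrix X Y ℝ := fun i j =>
  ((size (entrySq a) - Fintype.card X * rowSum (entrySq a) i) +
    (size (entrySq a) - Fintype.card Y * colSum (entrySq a) j)) * a i j

/-- `a` is the gradient flow (continuous matrix scaling) on `[0, ∞)` with input the
non-negative matrix `B₀`: `a_ij(0) = √(B₀)_ij` and `d/dt a_ij = velocity(a)_ij`. The scaled matrix
at time `t` is `entrySq (a t)`. -/
structure IsGradientFlow (B₀ : Matrix X Y ℝ) (a : ℝ → Matrix X Y ℝ) : Prop where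
  init : ∀ i j, a 0 i j = Real.sqrt (B₀ i j)
  deriv : ∀ t, 0 ≤ t → ∀ i j,
    HasDerivWithinAt (fun τ => a τ i j) (velocity (a t) i j) (Set.Ici 0) t

/-- `vol(S)` in an edge-weighted graph with symmetric non-negative weights `w`. -/
def vol (w : V → V → ℝ) (S : Finset V) : ℝ := ∑ i ∈ S, ∑ j, w i j

/-- The conductance `φ(S)` of a vertex set: weight of the edges leaving `S` over `vol(S)`. -/
def setConductance [DecidableEq V] (w : V → V → ℝ) (S : Finset V) : ℝ :=
  (∑ i ∈ S, ∑ j ∈ Sᶜ, w i j) / vol w S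

/-- The conductance `φ(G)` of an edge-weighted graph: the minimum of `φ(S)` over the vertex sets
`S` with `vol(S) ≤ vol(V) / 2`, where, as always, only sets with `vol(S) ≠ 0` count. -/
def conductance [DecidableEq V] (w : V → V → ℝ) : ℝ :=
  ⨅ S : {S : Finset V // 0 < vol w S ∧ vol w S ≤ vol w Finset.univ / 2}, setConductance w S.1

/-- The `0/1` matrix, with rows `X` and columns `Y`, of a bipartite graph with parts `X`, `Y`. -/
def biadjacency (G : SimpleGraph (X ⊕ Y)) [DecidableRel G.Adj] : Matrix X Y ℝ :=
  fun i j => if G.Adj (Sum.inl i) (Sum.inr j) then 1 else 0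

/-- `x` is an `η`-nearly perfect fractional matching of `G`: non-negative weights on the edges
of `G` whose sum at every vertex is within `η` of `1`. -/
structure IsNearlyPerfectFractionalMatching (G : SimpleGraph (X ⊕ Y)) (η : ℝ)
    (x : Matrix X Y ℝ) : Prop where
  nonneg : ∀ i j, 0 ≤ x i j
  support : ∀ i j, ¬ G.Adj (Sum.inl i) (Sum.inr j) → x i j = 0
  left : ∀ i, |rowSum x i - 1| ≤ η
  right : ∀ j, |colSum x j - 1| ≤ η

end MatrixScaling

end

noncomputable section

namespace MatrixScaling

open Finset

/-! Write `u i` and `v j` for the row and column defects, `s` for the size, and `Δ` for the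
imbalance, the sum of the mean squares of `u` and of `v`. On `B = (a_ij ^ 2)` the flow reads `B_ij'
= 2 (u_i + v_j) B_ij`. Hence `s' = -2 Δ` and `Δ' = -4 ∑ B_ij (u_i + v_j) ^ 2`. Since `u` and `v`
have sum zero, a Poincaré inequality for `B 0` with constant `κ` bounds the dissipation below and
makes `Δ` decay like `exp (-2 κ t)`, as long as no entry of `B` has fallen below half its initial
value. Cheeger's inequality supplies `κ = φ ^ 2 s₀ / 4`.

To see that entries stay large, let `δ = ε s₀` bound the initial defects. Decay of `Δ` limits the
loss of size to `δ`. A maximum principle (`defect_add_size_le`) shows that each defect grows by at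
most that loss, so all stay below `2 δ`. Interpolating with `u_i ^ 2 ≤ N Δ`, where `N = |X|`, gives
defects of order `δ exp (-κ t / (log N + 1))`; the logarithm is the price of passing from mean
square to maximum. Their time integrals are at most of order `δ (log N + 1) / κ`, which is small by
the assumption on `φ`. As `B t` is `B 0` times exponentials of these integrals, entries lose less
than was allowed, and a continuity argument (`forall_le_of_bootstrap`) extends the decay to all
times. The defects then fall below `η s` in the stated time. -/

lemma sq_sub_eq_posPart_negPart (a m : ℝ) :
    (a - m) ^ 2 = max (a - m) 0 ^ 2 + max (m - a) 0 ^ 2 := by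
  rcases le_total a m with h | h
  · rw [max_eq_right (by linarith), max_eq_left (by linarith)]; ring
  · rw [max_eq_left (by linarith), max_eq_right (by linarith)]; ring

lemma sq_sub_posPart_add_sq_sub_negPart_le (a b m : ℝ) :
    (max (a - m) 0 - max (b - m) 0) ^ 2 + (max (m - a) 0 - max (m - b) 0) ^ 2 ≤ (a - b) ^ 2 := by
  rcases le_total a m with h | h <;> rcases le_total b m with h' | h'
  · rw [max_eq_right (by linarith), max_eq_right (by linarith), max_eq_left (by linarith),
      max_eq_left (by linarith)]; nlinarith
  · rw [max_eq_right (by linarith), max_eq_left (by linarith), max_eq_left (by linarith),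
      max_eq_right (by linarith)]; nlinarith
  · rw [max_eq_left (by linarith), max_eq_right (by linarith), max_eq_right (by linarith),
      max_eq_left (by linarith)]; nlinarith
  · rw [max_eq_left (by linarith), max_eq_left (by linarith), max_eq_right (by linarith),
      max_eq_right (by linarith)]; nlinarith

/-! ### Cheeger's inequality for weighted graphs -/

section Cheeger

variable {V : Type*} [Fintype V] {w : V → V → ℝ}

lemma vol_nonneg (hw : ∀ x y, 0 ≤ w x y) (S : Finset V) : 0 ≤ vol w S :=
  sum_nonneg fun x _ => sum_nonneg fun y _ => hw x y

lemma vol_mono (hw : ∀ x y, 0 ≤ w x y) {S T : Finset V} (h : S ⊆ T) : vol w S ≤ vol w T :=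
  sum_le_sum_of_subset_of_nonneg h fun x _ _ => sum_nonneg fun y _ => hw x y

/-- The median is the least value of `f` whose sublevel set carries half the volume. If the strict
sublevel set had more than half, the largest value below would already qualify. -/
lemma exists_median (hw : ∀ x y, 0 ≤ w x y) (f : V → ℝ) :
    ∃ m, vol w {x | m < f x} ≤ vol w univ / 2 ∧ vol w {x | f x < m} ≤ vol w univ / 2 := by
  have h0 := vol_nonneg hw univ
  rcases isEmpty_or_nonempty V with hV | hV
  · exact ⟨0, by simp [vol], by simp [vol]⟩
  set T : Finset V := {x | vol w univ / 2 ≤ vol w {y | f y ≤ f x}} with hT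
  have hTne : T.Nonempty := by
    obtain ⟨x, -, hx⟩ := univ.exists_max_image f univ_nonempty
    refine ⟨x, ?_⟩
    have : ({y | f y ≤ f x} : Finset V) = univ := by
      ext y; simpa using hx y (mem_univ y)
    simp only [hT, mem_filter, mem_univ, true_and, this]
    linarith
  obtain ⟨x, hxT, hx⟩ := T.exists_min_image f hTne
  refine ⟨f x, ?_, ?_⟩
  · have h1 : vol w univ / 2 ≤ vol w {y | f y ≤ f x} := (mem_filter.1 hxT).2
    have h2 : vol w {y | f y ≤ f x} + vol w {y | f x < f y} = vol w univ := by
      have := sum_filter_add_sum_filter_not univ (fun y => f y ≤ f x) (fun y => ∑ z, w y z)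
      simp only [not_le] at this
      exact this
    linarith
  · by_contra! hlt
    have hne : ({y | f y < f x} : Finset V).Nonempty := by
      by_contra hem
      rw [not_nonempty_iff_eq_empty] at hem
      rw [hem] at hlt
      simp only [vol, sum_empty] at hlt h0
      linarith
    obtain ⟨z, hz, hzmax⟩ := exists_max_image _ f hne
    have hzx : f z < f x := (mem_filter.1 hz).2
    have hsub : ({y | f y < f x} : Finset V) ⊆ ({y | f y ≤ f z} : Finset V) := fun y hy => by
      simpa using hzmax y hy
    have : z ∈ T := by
      simp only [hT, mem_filter, mem_univ, true_and]
      exact hlt.le.trans (vol_mono hw hsub)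
    exact absurd (hx z this) (not_le.2 hzx)

variable [DecidableEq V]

lemma setConductance_nonneg (hw : ∀ x y, 0 ≤ w x y) (S : Finset V) : 0 ≤ setConductance w S :=
  div_nonneg (sum_nonneg fun x _ => sum_nonneg fun y _ => hw x y) (vol_nonneg hw S)

lemma setConductance_le_one (hw : ∀ x y, 0 ≤ w x y) (S : Finset V) : setConductance w S ≤ 1 :=
  div_le_one_of_le₀ (sum_le_sum fun x _ =>
    sum_le_sum_of_subset_of_nonneg (subset_univ _) fun y _ _ => hw x y) (vol_nonneg hw S)

lemma conductance_nonneg (hw : ∀ x y, 0 ≤ w x y) : 0 ≤ conductance w :=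
  Real.iInf_nonneg fun S => setConductance_nonneg hw S.1

lemma conductance_le_setConductance {S : Finset V} (h0 : 0 < vol w S)
    (h : vol w S ≤ vol w univ / 2) : conductance w ≤ setConductance w S :=
  ciInf_le (f := fun S : {S : Finset V // 0 < vol w S ∧ vol w S ≤ vol w univ / 2} =>
    setConductance w S.1) (Finite.bddBelow_range _) ⟨S, h0, h⟩

lemma conductance_le_one (hw : ∀ x y, 0 ≤ w x y) : conductance w ≤ 1 := by
  rcases isEmpty_or_nonempty {S : Finset V // 0 < vol w S ∧ vol w S ≤ vol w univ / 2} with h | ⟨⟨S⟩⟩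
  · rw [conductance, Real.iInf_of_isEmpty]
    exact zero_le_one
  · exact (conductance_le_setConductance S.2.1 S.2.2).trans (setConductance_le_one hw _)

lemma conductance_mul_vol_le (hw : ∀ x y, 0 ≤ w x y) {S : Finset V}
    (h : vol w S ≤ vol w univ / 2) :
    conductance w * vol w S ≤ ∑ x ∈ S, ∑ y ∈ Sᶜ, w x y := by
  rcases (vol_nonneg hw S).eq_or_lt with h0 | h0
  · rw [← h0, mul_zero]
    exact sum_nonneg fun x _ => sum_nonneg fun y _ => hw x y
  · exact (le_div_iff₀ h0).1 (conductance_le_setConductance h0 h)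

/-- The discrete co-area inequality. -/
lemma conductance_mul_sum_le (hw : ∀ x y, 0 ≤ w x y) (hs : ∀ x y, w x y = w y x) (h : V → ℝ)
    (h0 : ∀ x, 0 ≤ h x) (hvol : vol w {x | h x ≠ 0} ≤ vol w univ / 2) :
    2 * (conductance w * ∑ x, (∑ y, w x y) * h x) ≤ ∑ x, ∑ y, w x y * |h x - h y| := by
  induction hn : #{x | h x ≠ 0} using Nat.strong_induction_on generalizing h with
  | _ n ih =>
  set S : Finset V := {x | h x ≠ 0} with hS
  have hmemS : ∀ x, x ∈ S ↔ h x ≠ 0 := fun x => by simp [hS]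
  rcases S.eq_empty_or_nonempty with he | hne
  · have hz : ∀ x, h x = 0 := fun x => by
      by_contra hx
      have := (hmemS x).2 hx
      simp [he] at this
    simp [hz]
  obtain ⟨x₀, hx₀, hmin⟩ := S.exists_min_image h hne
  set c := h x₀
  have hc : 0 < c := lt_of_le_of_ne (h0 x₀) (Ne.symm ((hmemS x₀).1 hx₀))
  -- Peel off the lowest layer: subtracting the least positive value `c` on the support shrinks the
  -- support, so induction applies to `g`.
  set g : V → ℝ := fun x => if x ∈ S then h x - c else 0 with hg
  have hgS : ∀ x, x ∈ S → g x = h x - c := fun x hx => by simp [hg, hx]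
  have hgS' : ∀ x, x ∉ S → g x = 0 := fun x hx => by simp [hg, hx]
  have hhS' : ∀ x, x ∉ S → h x = 0 := fun x hx => by
    by_contra hx'
    exact hx ((hmemS x).2 hx')
  have hg0 : ∀ x, 0 ≤ g x := fun x => by
    by_cases hx : x ∈ S
    · rw [hgS x hx]; linarith [hmin x hx]
    · rw [hgS' x hx]
  have hsub : ({x | g x ≠ 0} : Finset V) ⊂ S := by
    refine (ssubset_iff_of_subset fun x hx => ?_).2 ⟨x₀, hx₀, by simp [hgS x₀ hx₀, c]⟩
    by_contra hxS
    exact (mem_filter.1 hx).2 (hgS' x hxS)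
  have key := ih _ (hn ▸ card_lt_card hsub) g hg0 ((vol_mono hw hsub.subset).trans hvol) rfl
  have hL : ∑ x, (∑ y, w x y) * h x = ∑ x, (∑ y, w x y) * g x + c * vol w S := by
    have : c * vol w S = ∑ x, (∑ y, w x y) * (if x ∈ S then c else 0) := by
      simp [vol, mul_sum, mul_comm]
    rw [this, ← sum_add_distrib]
    refine sum_congr rfl fun x _ => ?_
    by_cases hx : x ∈ S
    · rw [hgS x hx, if_pos hx]; ring
    · rw [hgS' x hx, if_neg hx, hhS' x hx]; ring
  have hcut : ∑ x ∈ S, ∑ y ∈ Sᶜ, w x y = ∑ x, ∑ y, w x y * (if x ∈ S ∧ y ∉ S then 1 else 0) := by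
    rw [← sum_subset (subset_univ S)]
    · refine sum_congr rfl fun x hx => ?_
      rw [← sum_subset (subset_univ Sᶜ)]
      · refine sum_congr rfl fun y hy => ?_
        rw [if_pos ⟨hx, mem_compl.1 hy⟩, mul_one]
      · intro y _ hy
        rw [if_neg (fun h => hy (mem_compl.2 h.2)), mul_zero]
    · intro x _ hx
      exact sum_eq_zero fun y _ => by rw [if_neg (fun h => hx h.1), mul_zero]
  have hcut' : ∑ x ∈ S, ∑ y ∈ Sᶜ, w x y = ∑ x, ∑ y, w x y * (if y ∈ S ∧ x ∉ S then 1 else 0) := by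
    rw [hcut, sum_comm]
    exact sum_congr rfl fun x _ => sum_congr rfl fun y _ => by rw [hs]
  -- The peeling changes `|h x - h y|` only across the boundary of `S`, by exactly `c`; each such
  -- edge occurs in both orders.
  have hR : ∑ x, ∑ y, w x y * |h x - h y| =
      ∑ x, ∑ y, w x y * |g x - g y| + 2 * (c * ∑ x ∈ S, ∑ y ∈ Sᶜ, w x y) := by
    rw [two_mul]
    nth_rewrite 1 [hcut]
    rw [hcut', mul_sum, mul_sum, ← sum_add_distrib, ← sum_add_distrib]
    refine sum_congr rfl fun x _ => ?_
    rw [mul_sum, mul_sum, ← sum_add_distrib, ← sum_add_distrib]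
    refine sum_congr rfl fun y _ => ?_
    by_cases hx : x ∈ S <;> by_cases hy : y ∈ S
    · simp [hx, hy, hgS]
    · have h1 := hmin x hx
      simp only [hx, hy, hgS x hx, hgS' y hy, hhS' y hy, sub_zero, abs_of_nonneg (h0 x),
        abs_of_nonneg (show 0 ≤ h x - c by linarith)]
      simp; ring
    · have h1 := hmin y hy
      simp only [hx, hy, hgS y hy, hgS' x hx, hhS' x hx, zero_sub, abs_neg, abs_of_nonneg (h0 y),
        abs_of_nonneg (show 0 ≤ h y - c by linarith)]
      simp; ring
    · simp [hx, hy, hgS', hhS']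
  have := mul_le_mul_of_nonneg_left (conductance_mul_vol_le hw hvol) hc.le
  rw [hL, hR]
  linarith

/-- Cheeger's inequality for a function supported on at most half of the volume. -/
lemma conductance_sq_mul_sum_le (hw : ∀ x y, 0 ≤ w x y) (hs : ∀ x y, w x y = w y x) (g : V → ℝ)
    (hvol : vol w {x | g x ≠ 0} ≤ vol w univ / 2) :
    conductance w ^ 2 * ∑ x, (∑ y, w x y) * g x ^ 2 ≤ ∑ x, ∑ y, w x y * (g x - g y) ^ 2 := by
  -- Apply the co-area inequality to `g ^ 2`, factor `g x ^ 2 - g y ^ 2` and use Cauchy–Schwarz.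
  have h1 := conductance_mul_sum_le hw hs (fun x => g x ^ 2) (fun x => sq_nonneg _)
    (by simpa using hvol)
  set A := ∑ x, (∑ y, w x y) * g x ^ 2 with hA
  set D := ∑ x, ∑ y, w x y * (g x - g y) ^ 2 with hD
  have hA0 : 0 ≤ A := sum_nonneg fun x _ => mul_nonneg (sum_nonneg fun y _ => hw x y) (sq_nonneg _)
  have hD0 : 0 ≤ D := sum_nonneg fun x _ => sum_nonneg fun y _ => mul_nonneg (hw x y) (sq_nonneg _)
  have hsum : ∑ x, ∑ y, w x y * (g x + g y) ^ 2 ≤ 4 * A := by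
    have e1 : ∑ x, ∑ y, w x y * g x ^ 2 = A := by simp only [hA, sum_mul]
    have e2 : ∑ x, ∑ y, w x y * g y ^ 2 = A := by
      rw [sum_comm, ← e1]
      exact sum_congr rfl fun x _ => sum_congr rfl fun y _ => by rw [hs]
    calc ∑ x, ∑ y, w x y * (g x + g y) ^ 2
        ≤ ∑ x, ∑ y, (2 * (w x y * g x ^ 2) + 2 * (w x y * g y ^ 2)) :=
          sum_le_sum fun x _ => sum_le_sum fun y _ => by
            nlinarith [mul_nonneg (hw x y) (sq_nonneg (g x - g y))]
      _ = 4 * A := by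
          simp only [sum_add_distrib, ← mul_sum, e1, e2]; ring
  have hCS : (∑ x, ∑ y, w x y * |g x ^ 2 - g y ^ 2|) ^ 2 ≤
      D * ∑ x, ∑ y, w x y * (g x + g y) ^ 2 := by
    rw [hD]
    simp only [← Fintype.sum_prod_type']
    refine sum_sq_le_sum_mul_sum_of_sq_le_mul _ (fun p _ => mul_nonneg (hw _ _) (sq_nonneg _))
      (fun p _ => mul_nonneg (hw _ _) (sq_nonneg _)) fun p _ => ?_
    rw [mul_pow, sq_abs]; exact le_of_eq (by ring)
  rcases hA0.eq_or_lt with h | h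
  · rw [← h, mul_zero]; exact hD0
  · have h2 := conductance_nonneg hw
    have h3 : (2 * (conductance w * A)) ^ 2 ≤ D * (4 * A) :=
      (pow_le_pow_left₀ (by positivity) h1 2).trans
        (hCS.trans (mul_le_mul_of_nonneg_left hsum hD0))
    refine le_of_mul_le_mul_right ?_ (show 0 < 4 * A by positivity)
    linarith

/-- **Cheeger's inequality**, as a Poincaré inequality around a median. -/
theorem exists_conductance_sq_mul_sum_le (hw : ∀ x y, 0 ≤ w x y) (hs : ∀ x y, w x y = w y x)
    (f : V → ℝ) : ∃ m, conductance w ^ 2 * ∑ x, (∑ y, w x y) * (f x - m) ^ 2 ≤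
      ∑ x, ∑ y, w x y * (f x - f y) ^ 2 := by
  obtain ⟨m, h1, h2⟩ := exists_median hw f
  refine ⟨m, ?_⟩
  have k1 := conductance_sq_mul_sum_le hw hs (fun x => max (f x - m) 0)
    (by simpa using h1)
  have k2 := conductance_sq_mul_sum_le hw hs (fun x => max (m - f x) 0)
    (by simpa using h2)
  calc conductance w ^ 2 * ∑ x, (∑ y, w x y) * (f x - m) ^ 2
      = conductance w ^ 2 * ∑ x, (∑ y, w x y) * max (f x - m) 0 ^ 2 +
        conductance w ^ 2 * ∑ x, (∑ y, w x y) * max (m - f x) 0 ^ 2 := by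
        rw [← mul_add, ← sum_add_distrib]
        simp only [← mul_add, ← sq_sub_eq_posPart_negPart]
    _ ≤ _ := add_le_add k1 k2
    _ ≤ _ := by
        rw [← sum_add_distrib]
        refine sum_le_sum fun x _ => ?_
        rw [← sum_add_distrib]
        refine sum_le_sum fun y _ => ?_
        rw [← mul_add]
        exact mul_le_mul_of_nonneg_left (sq_sub_posPart_add_sq_sub_negPart_le _ _ _) (hw x y)

/-- Cheeger's inequality for mean-zero functions, when all degrees are at least `d`. -/
theorem conductance_sq_mul_sum_sq_le (hw : ∀ x y, 0 ≤ w x y) (hs : ∀ x y, w x y = w y x) {d : ℝ}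
    (hd0 : 0 ≤ d) (hd : ∀ x, d ≤ ∑ y, w x y) (f : V → ℝ) (hf : ∑ x, f x = 0) :
    conductance w ^ 2 * d * ∑ x, f x ^ 2 ≤ ∑ x, ∑ y, w x y * (f x - f y) ^ 2 := by
  obtain ⟨m, hm⟩ := exists_conductance_sq_mul_sum_le hw hs f
  refine le_trans ?_ hm
  rw [mul_assoc]
  refine mul_le_mul_of_nonneg_left ?_ (sq_nonneg _)
  -- The median may be replaced by the mean `0`, since the mean minimises the unweighted second
  -- moment; this is why a lower bound on the degrees is needed.
  calc d * ∑ x, f x ^ 2 ≤ d * ∑ x, (f x - m) ^ 2 := by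
        refine mul_le_mul_of_nonneg_left ?_ hd0
        have : ∑ x, (f x - m) ^ 2 = ∑ x, f x ^ 2 - 2 * m * ∑ x, f x + Fintype.card V * m ^ 2 := by
          rw [mul_sum, ← sum_sub_distrib, ← nsmul_eq_mul, ← card_univ, ← sum_const,
            ← sum_add_distrib]
          exact sum_congr rfl fun x _ => by ring
        rw [this, hf]
        have : 0 ≤ (Fintype.card V : ℝ) * m ^ 2 := by positivity
        linarith
    _ ≤ _ := by
        rw [mul_sum]
        exact sum_le_sum fun x _ => mul_le_mul_of_nonneg_right (hd x) (sq_nonneg _)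

end Cheeger

/-! ### One-variable calculus -/

open Set

/-- Squaring makes the truncation differentiable at `0`, so that energies of excesses can be
differentiated in the maximum principle. -/
lemma hasDerivAt_max_zero_sq (x : ℝ) : HasDerivAt (fun x : ℝ => max x 0 ^ 2) (2 * max x 0) x := by
  rcases lt_trichotomy x 0 with h | rfl | h
  · rw [max_eq_right h.le, mul_zero]
    refine (hasDerivAt_const x (0 : ℝ)).congr_of_eventuallyEq ?_
    filter_upwards [Iio_mem_nhds h] with y hy
    rw [max_eq_right (le_of_lt hy)]; simp
  · have h1 : HasDerivWithinAt (fun x : ℝ => max x 0 ^ 2) (2 * max 0 0) (Iic 0) 0 := by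
      refine (hasDerivWithinAt_const (0 : ℝ) (Iic 0) (0 : ℝ)).congr_deriv (by simp)
        |>.congr (fun y hy => ?_) (by simp)
      rw [max_eq_right hy]; simp
    have h2 : HasDerivWithinAt (fun x : ℝ => max x 0 ^ 2) (2 * max 0 0) (Ici 0) 0 := by
      refine ((hasDerivAt_pow 2 (0 : ℝ)).hasDerivWithinAt (s := Ici 0)).congr_deriv (by simp)
        |>.congr (fun y hy => ?_) (by simp)
      rw [max_eq_left hy]
    have := h1.union h2
    rwa [Iic_union_Ici, hasDerivWithinAt_univ] at this
  · rw [max_eq_left h.le]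
    refine ((hasDerivAt_pow 2 x).congr_deriv (by simp)).congr_of_eventuallyEq ?_
    filter_upwards [Ioi_mem_nhds h] with y hy
    rw [max_eq_left (le_of_lt hy)]

lemma antitoneOn_Icc_of_hasDerivWithinAt {f f' : ℝ → ℝ} {T : ℝ}
    (hf : ∀ t ∈ Icc 0 T, HasDerivWithinAt f (f' t) (Ici 0) t) (hf' : ∀ t ∈ Icc 0 T, f' t ≤ 0) :
    AntitoneOn f (Icc 0 T) :=
  antitoneOn_of_hasDerivWithinAt_nonpos (convex_Icc 0 T)
    (fun t ht => (hf t ht).continuousWithinAt.mono Icc_subset_Ici_self)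
    (fun t ht => (hf t (interior_subset ht)).mono
      (interior_subset.trans Icc_subset_Ici_self))
    (fun t ht => hf' t (interior_subset ht))

lemma le_of_hasDerivWithinAt_nonpos {f f' : ℝ → ℝ} {t : ℝ} (ht : 0 ≤ t)
    (hf : ∀ t, 0 ≤ t → HasDerivWithinAt f (f' t) (Ici 0) t) (hf' : ∀ t, 0 ≤ t → f' t ≤ 0) :
    f t ≤ f 0 :=
  antitoneOn_Icc_of_hasDerivWithinAt (fun t ht => hf t ht.1) (fun t ht => hf' t ht.1)
    (left_mem_Icc.2 ht) (right_mem_Icc.2 ht) ht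

/-! ### Defects and imbalance of a matrix -/

variable {X Y : Type*} [Fintype X] [Fintype Y]

/-- The deviation `s(B) - m r_i(B)` of a row sum. -/
def rowDefect (B : Matrix X Y ℝ) (i : X) : ℝ := size B - Fintype.card X * rowSum B i

/-- The deviation `s(B) - n c_j(B)` of a column sum. -/
def colDefect (B : Matrix X Y ℝ) (j : Y) : ℝ := size B - Fintype.card Y * colSum B j

/-- The potential `(1/m) ∑ (s - m r_i)² + (1/n) ∑ (s - n c_j)²`. -/
def imbalance (B : Matrix X Y ℝ) : ℝ :=
  (∑ i, rowDefect B i ^ 2) / Fintype.card X + (∑ j, colDefect B j ^ 2) / Fintype.card Y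

lemma size_transpose (B : Matrix X Y ℝ) : size B.transpose = size B := sum_comm

lemma rowDefect_transpose (B : Matrix X Y ℝ) (j : Y) : rowDefect B.transpose j = colDefect B j := by
  rw [rowDefect, size_transpose]; rfl

lemma colDefect_transpose (B : Matrix X Y ℝ) (i : X) : colDefect B.transpose i = rowDefect B i := by
  rw [colDefect, size_transpose]; rfl

lemma imbalance_nonneg (B : Matrix X Y ℝ) : 0 ≤ imbalance B := by
  unfold imbalance; positivity

lemma sum_rowDefect (B : Matrix X Y ℝ) : ∑ i, rowDefect B i = 0 := by
  simp only [rowDefect, sum_sub_distrib, ← mul_sum, sum_const, card_univ, nsmul_eq_mul]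
  exact sub_self _

lemma sum_colDefect (B : Matrix X Y ℝ) : ∑ j, colDefect B j = 0 := by
  simpa only [rowDefect_transpose] using sum_rowDefect B.transpose

lemma sum_rowDefect_mul_rowSum (B : Matrix X Y ℝ) :
    ∑ i, rowDefect B i * rowSum B i = -((∑ i, rowDefect B i ^ 2) / Fintype.card X) := by
  rcases isEmpty_or_nonempty X with h | h
  · simp
  have hm : (Fintype.card X : ℝ) ≠ 0 := by exact_mod_cast Fintype.card_ne_zero
  have h1 : ∀ i, rowDefect B i * rowSum B i =
      rowDefect B i * (size B / Fintype.card X) - rowDefect B i ^ 2 / Fintype.card X := fun i => by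
    have : rowSum B i = (size B - rowDefect B i) / Fintype.card X := by
      rw [rowDefect, sub_sub_cancel, mul_div_cancel_left₀ _ hm]
    rw [this]; ring
  simp only [h1, sum_sub_distrib, ← sum_mul, sum_rowDefect, zero_mul, zero_sub, ← sum_div]

lemma sum_colDefect_mul_colSum (B : Matrix X Y ℝ) :
    ∑ j, colDefect B j * colSum B j = -((∑ j, colDefect B j ^ 2) / Fintype.card Y) := by
  have := sum_rowDefect_mul_rowSum B.transpose
  simp only [rowDefect_transpose] at this
  exact this

lemma sum_defect_mul (B : Matrix X Y ℝ) :
    ∑ i, ∑ j, (rowDefect B i + colDefect B j) * B i j = -imbalance B := by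
  simp only [add_mul, sum_add_distrib]
  rw [sum_comm (f := fun i j => colDefect B j * B i j)]
  simp only [← mul_sum]
  rw [imbalance, neg_add, ← sum_rowDefect_mul_rowSum, ← sum_colDefect_mul_colSum]
  rfl

/-- The common computation behind the dissipation identity and the maximum principle. Here `2 M`
stands for the derivative of `B`, `b` and `c` for the drift common to all rows or all columns, and
`p`, `q` for the weights produced by the chain rule. -/
lemma sum_defect_deriv [Nonempty X] [Nonempty Y] (M : X → Y → ℝ) (p : X → ℝ) (q : Y → ℝ)
    (b c : ℝ) :
    (∑ i, p i * (b - Fintype.card X * (2 * ∑ j, M i j))) / Fintype.card X +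
      (∑ j, q j * (c - Fintype.card Y * (2 * ∑ i, M i j))) / Fintype.card Y =
    b / Fintype.card X * ∑ i, p i + c / Fintype.card Y * ∑ j, q j -
      2 * ∑ i, ∑ j, (p i + q j) * M i j := by
  have hm : (Fintype.card X : ℝ) ≠ 0 := by exact_mod_cast Fintype.card_ne_zero
  have hn : (Fintype.card Y : ℝ) ≠ 0 := by exact_mod_cast Fintype.card_ne_zero
  have e1 : ∀ i, p i * (b - Fintype.card X * (2 * ∑ j, M i j)) / Fintype.card X =
      b / Fintype.card X * p i - 2 * ∑ j, p i * M i j := fun i => by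
    rw [← mul_sum]; field_simp
  have e2 : ∀ j, q j * (c - Fintype.card Y * (2 * ∑ i, M i j)) / Fintype.card Y =
      c / Fintype.card Y * q j - 2 * ∑ i, q j * M i j := fun j => by
    rw [← mul_sum]; field_simp
  simp only [sum_div, e1, e2, sum_sub_distrib, ← mul_sum, add_mul, sum_add_distrib]
  rw [sum_comm (f := fun i j => q j * M i j)]
  simp only [← mul_sum]
  ring

/-- The flow on the scaled matrices `B = (a_ij ^ 2)` which is induced by the gradient flow. -/
structure IsScalingFlow (B : ℝ → Matrix X Y ℝ) : Prop where
  nonneg : ∀ t, 0 ≤ t → ∀ i j, 0 ≤ B t i j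
  deriv : ∀ t, 0 ≤ t → ∀ i j, HasDerivWithinAt (fun τ => B τ i j)
    (2 * ((rowDefect (B t) i + colDefect (B t) j) * B t i j)) (Ici 0) t

lemma IsGradientFlow.isScalingFlow {B₀ : Matrix X Y ℝ} {a : ℝ → Matrix X Y ℝ}
    (h : IsGradientFlow B₀ a) : IsScalingFlow fun t => entrySq (a t) where
  nonneg _ _ _ _ := sq_nonneg _
  deriv t ht i j := ((h.deriv t ht i j).fun_pow 2).congr_deriv (by
    simp only [velocity, entrySq, rowDefect, colDefect]; ring)

/-! ### Evolution of size, defects and imbalance -/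

namespace IsScalingFlow

variable {B : ℝ → Matrix X Y ℝ} (hB : IsScalingFlow B)

include hB

lemma transpose : IsScalingFlow fun t => (B t).transpose where
  nonneg t ht i j := hB.nonneg t ht j i
  deriv t ht i j := (hB.deriv t ht j i).congr_deriv (by
    rw [rowDefect_transpose, colDefect_transpose, add_comm (colDefect _ _)]; rfl)

lemma hasDeriv_rowSum {t : ℝ} (ht : 0 ≤ t) (i : X) : HasDerivWithinAt (fun τ => rowSum (B τ) i)
    (2 * ∑ j, (rowDefect (B t) i + colDefect (B t) j) * B t i j) (Ici 0) t := by
  rw [mul_sum]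
  exact HasDerivWithinAt.fun_sum fun j _ => hB.deriv t ht i j

lemma hasDeriv_size {t : ℝ} (ht : 0 ≤ t) : HasDerivWithinAt (fun τ => size (B τ))
    (-2 * imbalance (B t)) (Ici 0) t := by
  have : HasDerivWithinAt (fun τ => size (B τ)) (∑ i, 2 * ∑ j, (rowDefect (B t) i +
      colDefect (B t) j) * B t i j) (Ici 0) t :=
    HasDerivWithinAt.fun_sum fun i _ => hB.hasDeriv_rowSum ht i
  refine this.congr_deriv ?_
  rw [← mul_sum, sum_defect_mul]; ring

lemma hasDeriv_rowDefect {t : ℝ} (ht : 0 ≤ t) (i : X) :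
    HasDerivWithinAt (fun τ => rowDefect (B τ) i) (-2 * imbalance (B t) - Fintype.card X *
      (2 * ∑ j, (rowDefect (B t) i + colDefect (B t) j) * B t i j)) (Ici 0) t :=
  (hB.hasDeriv_size ht).sub ((hB.hasDeriv_rowSum ht i).const_mul _)

lemma hasDeriv_colDefect {t : ℝ} (ht : 0 ≤ t) (j : Y) :
    HasDerivWithinAt (fun τ => colDefect (B τ) j) (-2 * imbalance (B t) - Fintype.card Y *
      (2 * ∑ i, (rowDefect (B t) i + colDefect (B t) j) * B t i j)) (Ici 0) t := by
  have h := hB.transpose.hasDeriv_rowDefect ht j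
  simp only [rowDefect_transpose, colDefect_transpose, add_comm (colDefect _ _)] at h
  refine h.congr_deriv ?_
  simp only [imbalance, rowDefect_transpose, colDefect_transpose, Matrix.transpose_apply]
  ring

section

variable [Nonempty X] [Nonempty Y]

/-- In `sum_defect_deriv` with weights `2 u` and `2 v`, the terms from the change of size vanish
because the defects sum to zero. -/
lemma hasDeriv_imbalance {t : ℝ} (ht : 0 ≤ t) : HasDerivWithinAt (fun τ => imbalance (B τ))
    (-4 * ∑ i, ∑ j, B t i j * (rowDefect (B t) i + colDefect (B t) j) ^ 2) (Ici 0) t := by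
  have h := ((HasDerivWithinAt.fun_sum (u := univ) fun i _ =>
    (hB.hasDeriv_rowDefect ht i).fun_pow 2).div_const (Fintype.card X : ℝ)).add
    ((HasDerivWithinAt.fun_sum (u := univ) fun j _ =>
    (hB.hasDeriv_colDefect ht j).fun_pow 2).div_const (Fintype.card Y : ℝ))
  refine HasDerivWithinAt.congr_deriv h ?_
  have key := sum_defect_deriv (fun i j => (rowDefect (B t) i + colDefect (B t) j) * B t i j)
    (fun i => 2 * rowDefect (B t) i) (fun j => 2 * colDefect (B t) j)
    (-2 * imbalance (B t)) (-2 * imbalance (B t))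
  simp only [Nat.cast_ofNat, Nat.add_one_sub_one, pow_one]
  rw [key]
  simp only [← mul_sum, sum_rowDefect, sum_colDefect, mul_zero, add_zero, zero_sub]
  rw [show (-4 : ℝ) = -2 * 2 by norm_num, mul_assoc, neg_mul, mul_sum univ _ (2 : ℝ)]
  simp only [mul_sum univ _ (2 : ℝ)]
  refine congrArg Neg.neg (sum_congr rfl fun i _ => sum_congr rfl fun j _ => ?_)
  ring

/-- The maximum principle: `s + max (u, -v)` is non-increasing, for the defects `u` of the rows
and `v` of the columns. -/
lemma defect_add_size_le {M t : ℝ} (ht : 0 ≤ t) (hr : ∀ i, rowDefect (B 0) i + size (B 0) ≤ M)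
    (hc : ∀ j, -colDefect (B 0) j + size (B 0) ≤ M) :
    (∀ i, rowDefect (B t) i + size (B t) ≤ M) ∧ ∀ j, -colDefect (B t) j + size (B t) ≤ M := by
  -- `E` measures the excess over `M`. Adding the size turns the common drift of `u` into `-4 Δ` and
  -- that of `-v` into `0`, so neither drift can increase `E`.
  set E : ℝ → ℝ := fun t =>
    (∑ i, max (rowDefect (B t) i + size (B t) - M) 0 ^ 2) / Fintype.card X +
    (∑ j, max (-colDefect (B t) j + size (B t) - M) 0 ^ 2) / Fintype.card Y with hE
  have hE0 : E 0 = 0 := by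
    have h1 : ∀ i, max (rowDefect (B 0) i + size (B 0) - M) 0 = 0 := fun i =>
      max_eq_right (by linarith [hr i])
    have h2 : ∀ j, max (-colDefect (B 0) j + size (B 0) - M) 0 = 0 := fun j =>
      max_eq_right (by linarith [hc j])
    simp [hE, h1, h2]
  have hd : ∀ t, 0 ≤ t → HasDerivWithinAt E _ (Ici 0) t := fun t ht =>
    ((HasDerivWithinAt.fun_sum (u := univ) fun i _ =>
      (hasDerivAt_max_zero_sq _).comp_hasDerivWithinAt t
      (((hB.hasDeriv_rowDefect ht i).add (hB.hasDeriv_size ht)).sub_const M)).div_const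
        (Fintype.card X : ℝ)).add
    ((HasDerivWithinAt.fun_sum (u := univ) fun j _ =>
      (hasDerivAt_max_zero_sq _).comp_hasDerivWithinAt t
      (((hB.hasDeriv_colDefect ht j).neg.add (hB.hasDeriv_size ht)).sub_const M)).div_const
        (Fintype.card Y : ℝ))
  have hle : E t ≤ 0 := by
    rw [← hE0]
    refine le_of_hasDerivWithinAt_nonpos ht hd fun t ht => ?_
    simp only [Pi.add_apply, Pi.neg_apply]
    set u := rowDefect (B t)
    set v := colDefect (B t)
    set s := size (B t)
    set Δ := imbalance (B t)
    have key := sum_defect_deriv (fun i j => (u i + v j) * B t i j)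
      (fun i => 2 * max (u i + s - M) 0) (fun j => -(2 * max (-v j + s - M) 0)) (-4 * Δ) 0
    have e1 : ∀ i, 2 * max (u i + s - M) 0 * (-2 * Δ - Fintype.card X *
        (2 * ∑ j, (u i + v j) * B t i j) + -2 * Δ) = 2 * max (u i + s - M) 0 *
        (-4 * Δ - Fintype.card X * (2 * ∑ j, (u i + v j) * B t i j)) := fun i => by ring
    have e2 : ∀ j, 2 * max (-v j + s - M) 0 * (-(-2 * Δ - Fintype.card Y *
        (2 * ∑ i, (u i + v j) * B t i j)) + -2 * Δ) = -(2 * max (-v j + s - M) 0) *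
        (0 - Fintype.card Y * (2 * ∑ i, (u i + v j) * B t i j)) := fun j => by ring
    simp only [e1, e2]
    rw [key]
    have h1 : 0 ≤ Δ / Fintype.card X * ∑ i, max (u i + s - M) 0 :=
      mul_nonneg (div_nonneg (imbalance_nonneg _) (Nat.cast_nonneg _))
        (sum_nonneg fun i _ => le_max_right _ _)
    -- The two truncated quantities differ before truncation by `u i + v j`. Truncation is monotone,
    -- so the two factors never have opposite signs.
    have h2 : 0 ≤ ∑ i, ∑ j, (2 * max (u i + s - M) 0 + -(2 * max (-v j + s - M) 0)) *
        ((u i + v j) * B t i j) := by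
      refine sum_nonneg fun i _ => sum_nonneg fun j _ => ?_
      rw [← mul_assoc]
      refine mul_nonneg ?_ (hB.nonneg t ht i j)
      rcases le_total 0 (u i + v j) with h | h
      · have := max_le_max_right (0 : ℝ) (show -v j + s - M ≤ u i + s - M by linarith)
        exact mul_nonneg (by linarith) h
      · have := max_le_max_right (0 : ℝ) (show u i + s - M ≤ -v j + s - M by linarith)
        exact mul_nonneg_of_nonpos_of_nonpos (by linarith) h
    rw [← mul_sum, zero_div, zero_mul, add_zero]
    have : -4 * Δ / Fintype.card X * (2 * ∑ i, max (u i + s - M) 0) =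
      -8 * (Δ / Fintype.card X * ∑ i, max (u i + s - M) 0) := by ring
    rw [this]
    linarith
  have hm : (0 : ℝ) < Fintype.card X := by exact_mod_cast Fintype.card_pos
  have hn : (0 : ℝ) < Fintype.card Y := by exact_mod_cast Fintype.card_pos
  have p1 : 0 ≤ ∑ i, max (rowDefect (B t) i + size (B t) - M) 0 ^ 2 :=
    sum_nonneg fun i _ => sq_nonneg _
  have p2 : 0 ≤ ∑ j, max (-colDefect (B t) j + size (B t) - M) 0 ^ 2 :=
    sum_nonneg fun i _ => sq_nonneg _
  have z := (add_eq_zero_iff_of_nonneg (div_nonneg p1 hm.le) (div_nonneg p2 hn.le)).1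
    (le_antisymm hle (add_nonneg (div_nonneg p1 hm.le) (div_nonneg p2 hn.le)))
  have z1 := (sum_eq_zero_iff_of_nonneg fun i _ => sq_nonneg _).1
    ((div_eq_zero_iff.1 z.1).resolve_right hm.ne')
  have z2 := (sum_eq_zero_iff_of_nonneg fun i _ => sq_nonneg _).1
    ((div_eq_zero_iff.1 z.2).resolve_right hn.ne')
  exact ⟨fun i => by
      have := max_eq_right_iff.1 (pow_eq_zero_iff two_ne_zero |>.1 (z1 i (mem_univ i)))
      linarith,
    fun j => by
      have := max_eq_right_iff.1 (pow_eq_zero_iff two_ne_zero |>.1 (z2 j (mem_univ j)))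
      linarith⟩

/-- The defects grow at most by as much as the size has shrunk. -/
lemma abs_defect_le {M t : ℝ} (ht : 0 ≤ t) (hr : ∀ i, |rowDefect (B 0) i| ≤ M)
    (hc : ∀ j, |colDefect (B 0) j| ≤ M) :
    (∀ i, |rowDefect (B t) i| ≤ M + (size (B 0) - size (B t))) ∧
      ∀ j, |colDefect (B t) j| ≤ M + (size (B 0) - size (B t)) := by
  have h1 := hB.defect_add_size_le (M := M + size (B 0)) ht
    (fun i => by linarith [(abs_le.1 (hr i)).2]) (fun j => by linarith [(abs_le.1 (hc j)).1])
  -- Transposing swaps the roles of `u` and `v` and yields the two missing one-sided bounds.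
  have h2 := hB.transpose.defect_add_size_le (M := M + size (B 0)) ht
    (fun j => by
      rw [rowDefect_transpose, size_transpose]; linarith [(abs_le.1 (hc j)).2])
    (fun i => by
      rw [colDefect_transpose, size_transpose]; linarith [(abs_le.1 (hr i)).1])
  simp only [rowDefect_transpose, colDefect_transpose, size_transpose] at h2
  exact ⟨fun i => abs_le.2 ⟨by linarith [h2.2 i], by linarith [h1.1 i]⟩,
    fun j => abs_le.2 ⟨by linarith [h1.2 j], by linarith [h2.1 j]⟩⟩

end

/-- Along the flow the matrix is scaled by the exponentials of twice the integrated defects. -/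
lemma exists_potentials : ∃ (p : X → ℝ → ℝ) (q : Y → ℝ → ℝ), (∀ i, p i 0 = 0) ∧ (∀ j, q j 0 = 0) ∧
    (∀ t, 0 ≤ t → ∀ i, HasDerivWithinAt (p i) (rowDefect (B t) i) (Ici 0) t) ∧
    (∀ t, 0 ≤ t → ∀ j, HasDerivWithinAt (q j) (colDefect (B t) j) (Ici 0) t) ∧
    ∀ t, 0 ≤ t → ∀ i j, B t i j = B 0 i j * Real.exp (2 * (p i t + q j t)) := by
  have hint : ∀ f : ℝ → ℝ, ContinuousOn f (Ici 0) →
      ∃ F : ℝ → ℝ, F 0 = 0 ∧ ∀ t, 0 ≤ t → HasDerivWithinAt F (f t) (Ici 0) t := fun f hf => by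
    -- Freezing `f` at its value at `0` for negative times gives a continuous integrand on the whole
    -- line.
    have hc : Continuous fun t => f (max t 0) :=
      hf.comp_continuous (by fun_prop) fun t => mem_Ici.2 (le_max_right _ _)
    refine ⟨fun t => ∫ τ in (0 : ℝ)..t, f (max τ 0), by simp, fun t ht => ?_⟩
    have := (hc.integral_hasStrictDerivAt 0 t).hasDerivAt.hasDerivWithinAt (s := Ici 0)
    rwa [max_eq_left ht] at this
  choose p hp0 hp using fun i => hint (fun t => rowDefect (B t) i)
    fun t ht => (hB.hasDeriv_rowDefect ht i).continuousWithinAt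
  choose q hq0 hq using fun j => hint (fun t => colDefect (B t) j)
    fun t ht => (hB.hasDeriv_colDefect ht j).continuousWithinAt
  refine ⟨p, q, hp0, hq0, fun t ht i => hp i t ht, fun t ht j => hq j t ht, fun t ht i j => ?_⟩
  have hd : ∀ t, 0 ≤ t → HasDerivWithinAt
      (fun t => B t i j * Real.exp (-(2 * (p i t + q j t)))) 0 (Ici 0) t := fun t ht =>
    ((hB.deriv t ht i j).mul
      ((((hp i t ht).add (hq j t ht)).const_mul 2).neg.exp)).congr_deriv (by
        simp only [Pi.add_apply, Pi.neg_apply]; ring)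
  have h1 := le_of_hasDerivWithinAt_nonpos ht hd fun _ _ => le_rfl
  have h2 := le_of_hasDerivWithinAt_nonpos ht (fun t ht => (hd t ht).neg) fun _ _ => by simp
  have h3 : B t i j * Real.exp (-(2 * (p i t + q j t))) = B 0 i j := by
    simp only [Pi.neg_apply, hp0, hq0] at h1 h2
    simp at h1 h2
    exact le_antisymm h1 h2
  rw [← h3, mul_assoc, ← Real.exp_add]
  simp

end IsScalingFlow
/-- Two bounds on `x`, one of them decaying from a factor `√N` too large, give a bound which decays
from the start at a rate that is smaller by a factor `log N + 1`. -/
lemma abs_le_mul_exp_of_sq_le {x A N y : ℝ} (hN : 1 ≤ N) (hA : |x| ≤ A)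
    (hx : x ^ 2 ≤ N * (A * Real.exp (-y)) ^ 2) :
    |x| ≤ A * Real.exp (1 - y / (Real.log N + 1)) := by
  have hA0 : 0 ≤ A := (abs_nonneg x).trans hA
  have hl : 0 ≤ Real.log N := Real.log_nonneg hN
  set L := Real.log N + 1 with hL
  have hL0 : 0 < L := by linarith
  rcases le_total y L with h | h
  · refine hA.trans (le_mul_of_one_le_right hA0 (Real.one_le_exp ?_))
    rw [sub_nonneg]
    exact (div_le_one hL0).2 h
  · refine abs_le_of_sq_le_sq (hx.trans ?_) (by positivity)
    have hNe : N = Real.exp (L - 1) := by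
      rw [hL, add_sub_cancel_right, Real.exp_log (by linarith)]
    have hz : 1 ≤ y / L := (one_le_div hL0).2 h
    have hy : y = y / L * L := (div_mul_cancel₀ y hL0.ne').symm
    -- With `z = y / L ≥ 1` the claim becomes `(L - 1) - 2 z (L - 1) ≤ 2`.
    rw [hNe, mul_pow, mul_pow, mul_left_comm, ← Real.exp_nat_mul, ← Real.exp_nat_mul,
      ← Real.exp_add]
    refine mul_le_mul_of_nonneg_left (Real.exp_le_exp.2 ?_) (sq_nonneg A)
    push_cast
    nlinarith [mul_le_mul_of_nonneg_right hz hl]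

/-- A bound that improves itself holds for all times. -/
lemma forall_le_of_bootstrap {ι : Type*} [Finite ι] {f : ι → ℝ → ℝ} {a b : ℝ} (hab : a < b)
    (hf : ∀ k, ContinuousOn (f k) (Ici 0)) (h0 : ∀ k, b ≤ f k 0)
    (h : ∀ T, 0 ≤ T → (∀ t ∈ Set.Icc 0 T, ∀ k, a ≤ f k t) → ∀ k, b ≤ f k T) (T : ℝ) (hT : 0 ≤ T)
    (k : ι) : b ≤ f k T := by
  suffices hgood : ∀ t ∈ Set.Icc 0 T, ∀ k, a ≤ f k t from h T hT hgood k
  by_contra! hbad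
  obtain ⟨t₁, ht₁, k₁, hk₁⟩ := hbad
  have hcl : IsClosed (⋃ k, Set.Icc 0 T ∩ f k ⁻¹' Iic a) := isClosed_iUnion_of_finite fun k =>
    ((hf k).mono Icc_subset_Ici_self).preimage_isClosed_of_isClosed isClosed_Icc isClosed_Iic
  -- `t₀` is the first time at which some `f k` is at most `a`. Up to and including `t₀` all are at
  -- least `a`, so the hypothesis forces `b ≤ a` there.
  obtain ⟨t₀, ht₀, hmin⟩ := (isCompact_Icc.of_isClosed_subset hcl
    (iUnion_subset fun k => inter_subset_left)).exists_isLeast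
    ⟨t₁, mem_iUnion.2 ⟨k₁, ht₁, hk₁.le⟩⟩
  obtain ⟨k₀, ht₀T, hk₀⟩ := mem_iUnion.1 ht₀
  have hgood : ∀ t ∈ Set.Icc 0 t₀, ∀ k, a ≤ f k t := by
    intro t ht k
    by_contra! hlt
    obtain ⟨τ, hτ, hτa⟩ := intermediate_value_Icc' ht.1
      ((hf k).mono Icc_subset_Ici_self) ⟨hlt.le, hab.le.trans (h0 k)⟩
    have h1 : t₀ ≤ τ := hmin (mem_iUnion.2
      ⟨k, ⟨hτ.1, hτ.2.trans (ht.2.trans ht₀T.2)⟩, hτa.le⟩)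
    have h2 : τ = t := le_antisymm hτ.2 (ht.2.trans h1)
    exact hlt.ne (h2 ▸ hτa)
  exact absurd (h t₀ ht₀T.1 hgood k₀) (not_le.2 (hab.trans_le' hk₀))

/-- Subtracting `p` from the primitive-type majorant `(2 δ L / κ) exp (1 - κ t / L)` leaves an
antitone function, so `p` cannot drop below `-2 e δ L / κ ≥ -2 e / 100 > -1 / 16`. -/
lemma neg_le_of_abs_deriv_le {p p' : ℝ → ℝ} {T κ δ L : ℝ} (hκ : 0 < κ) (hL : 1 ≤ L) (hδ0 : 0 ≤ δ)
    (hδ : 100 * (δ * L) ≤ κ) (hp0 : p 0 = 0)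
    (hp : ∀ t ∈ Set.Icc 0 T, HasDerivWithinAt p (p' t) (Ici 0) t)
    (hp' : ∀ t ∈ Set.Icc 0 T, |p' t| ≤ 2 * δ * Real.exp (1 - κ * t / L))
    (hT : 0 ≤ T) : -(1 / 16) ≤ p T := by
  have hL0 : 0 < L := by linarith
  have hd : ∀ t ∈ Set.Icc 0 T, HasDerivWithinAt
      (fun t => 2 * δ * L / κ * Real.exp (1 - κ * t / L) - p t) _ (Ici 0) t := fun t ht =>
    (((((hasDerivWithinAt_id t _).const_mul κ).div_const L).const_sub 1).exp.const_mul
      (2 * δ * L / κ)).sub (hp t ht)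
  have h := antitoneOn_Icc_of_hasDerivWithinAt hd (fun t ht => by
    have h1 := (abs_le.1 (hp' t ht)).1
    have : 2 * δ * L / κ * (Real.exp (1 - κ * t / L) * -(κ * 1 / L)) =
      -(2 * δ * Real.exp (1 - κ * t / L)) := by field_simp
    simp only [id]
    rw [this]
    linarith) (left_mem_Icc.2 hT) (right_mem_Icc.2 hT) hT
  simp only [mul_zero, zero_div, sub_zero, hp0] at h
  have h1 : 0 ≤ 2 * δ * L / κ * Real.exp (1 - κ * T / L) := by positivity
  have h2 : δ * L / κ ≤ 1 / 100 := by
    rw [div_le_iff₀ hκ]; linarith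
  have h3 : 2 * δ * L / κ * Real.exp 1 = 2 * (δ * L / κ) * Real.exp 1 := by ring
  have h4 := mul_le_mul_of_nonneg_right h2 (Real.exp_nonneg 1)
  have h5 := Real.exp_one_lt_d9
  linarith

/-! ### Decay of the defects under a Poincaré inequality -/

namespace IsScalingFlow

variable [Nonempty X] [Nonempty Y] {B : ℝ → Matrix X Y ℝ} (hB : IsScalingFlow B)

include hB

lemma imbalance_eq_zero (h0 : imbalance (B 0) = 0) {t : ℝ} (ht : 0 ≤ t) : imbalance (B t) = 0 :=
  le_antisymm (h0 ▸ le_of_hasDerivWithinAt_nonpos (f := fun t => imbalance (B t)) ht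
    (fun t ht => hB.hasDeriv_imbalance ht) fun t ht => by
      have : 0 ≤ ∑ i, ∑ j, B t i j * (rowDefect (B t) i + colDefect (B t) j) ^ 2 :=
        sum_nonneg fun i _ => sum_nonneg fun j _ => mul_nonneg (hB.nonneg t ht i j) (sq_nonneg _)
      linarith) (imbalance_nonneg _)

variable {κ : ℝ} (hP : ∀ (f : X → ℝ) (g : Y → ℝ), ∑ i, f i = 0 → ∑ j, g j = 0 →
  κ * ((∑ i, f i ^ 2) / Fintype.card X + (∑ j, g j ^ 2) / Fintype.card Y) ≤
    ∑ i, ∑ j, B 0 i j * (f i + g j) ^ 2)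

include hP

/-- Exponential decay of the imbalance, as long as no entry has shrunk by more than half. -/
lemma imbalance_le_mul_exp {T : ℝ} (hT : ∀ t ∈ Set.Icc 0 T, ∀ i j, B 0 i j / 2 ≤ B t i j) :
    ∀ t ∈ Set.Icc 0 T, imbalance (B t) ≤ imbalance (B 0) * Real.exp (-(2 * κ * t)) := by
  have hd : ∀ t ∈ Set.Icc 0 T, HasDerivWithinAt
      (fun t => imbalance (B t) * Real.exp (2 * κ * t)) _ (Ici 0) t := fun t ht =>
    (hB.hasDeriv_imbalance ht.1).mul ((hasDerivWithinAt_id t _).const_mul (2 * κ)).exp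
  have hanti := antitoneOn_Icc_of_hasDerivWithinAt hd fun t ht => by
    have h1 := hP _ _ (sum_rowDefect (B t)) (sum_colDefect (B t))
    -- The Poincaré inequality is known only for `B 0`; passing to `B t` costs a factor 2, which
    -- leaves the rate `4 κ / 2`.
    have h2 : ∑ i, ∑ j, B 0 i j * (rowDefect (B t) i + colDefect (B t) j) ^ 2 ≤
        2 * ∑ i, ∑ j, B t i j * (rowDefect (B t) i + colDefect (B t) j) ^ 2 := by
      simp only [mul_sum]
      refine sum_le_sum fun i _ => sum_le_sum fun j _ => ?_
      rw [← mul_assoc]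
      exact mul_le_mul_of_nonneg_right (by linarith [hT t ht i j]) (sq_nonneg _)
    have h3 : κ * imbalance (B t) ≤
        2 * ∑ i, ∑ j, B t i j * (rowDefect (B t) i + colDefect (B t) j) ^ 2 := h1.trans h2
    have h4 := mul_le_mul_of_nonneg_right h3 (Real.exp_nonneg (2 * κ * t))
    simp only [id]
    linarith
  intro t ht
  have h := hanti (left_mem_Icc.2 (ht.1.trans ht.2)) ht ht.1
  simp only [mul_zero, Real.exp_zero, mul_one] at h
  rw [Real.exp_neg, ← div_eq_mul_inv]
  exact (le_div_iff₀ (Real.exp_pos _)).2 h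

variable {δ N : ℝ} (hκ : 0 < κ) (hr : ∀ i, |rowDefect (B 0) i| ≤ δ)
  (hc : ∀ j, |colDefect (B 0) j| ≤ δ)
  (hN : 1 ≤ N) (hX : Fintype.card X ≤ N) (hY : Fintype.card Y ≤ N)
  (hδ : 100 * (δ * (Real.log N + 1)) ≤ κ)

include hκ hr hc hN hX hY hδ

/-- The size loses at most `2 δ ^ 2 / κ ≤ δ`, so the maximum principle keeps the defects below `2
δ`. Interpolating with `u_i ^ 2 ≤ N Δ` gives the decay. -/
lemma defect_le_mul_exp {T : ℝ} (hT : ∀ t ∈ Set.Icc 0 T, ∀ i j, B 0 i j / 2 ≤ B t i j) :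
    ∀ t ∈ Set.Icc 0 T, size (B 0) - δ ≤ size (B t) ∧
      (∀ i, |rowDefect (B t) i| ≤ 2 * δ * Real.exp (1 - κ * t / (Real.log N + 1))) ∧
      ∀ j, |colDefect (B t) j| ≤ 2 * δ * Real.exp (1 - κ * t / (Real.log N + 1)) := by
  have hm : (0 : ℝ) < Fintype.card X := by exact_mod_cast Fintype.card_pos
  have hn : (0 : ℝ) < Fintype.card Y := by exact_mod_cast Fintype.card_pos
  have hδ0 : 0 ≤ δ := (abs_nonneg _).trans (hr (Classical.arbitrary X))
  have hδκ : 100 * δ ≤ κ := by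
    have := mul_nonneg hδ0 (Real.log_nonneg hN)
    linarith
  have hΔ := hB.imbalance_le_mul_exp hP hT
  have hΔ0 : imbalance (B 0) ≤ 2 * δ ^ 2 := by
    have h1 : (∑ i, rowDefect (B 0) i ^ 2) / Fintype.card X ≤ δ ^ 2 := by
      rw [div_le_iff₀ hm, mul_comm, ← nsmul_eq_mul, ← card_univ, ← sum_const]
      exact sum_le_sum fun i _ => sq_le_sq' (abs_le.1 (hr i)).1 (abs_le.1 (hr i)).2
    have h2 : (∑ j, colDefect (B 0) j ^ 2) / Fintype.card Y ≤ δ ^ 2 := by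
      rw [div_le_iff₀ hn, mul_comm, ← nsmul_eq_mul, ← card_univ, ← sum_const]
      exact sum_le_sum fun i _ => sq_le_sq' (abs_le.1 (hc i)).1 (abs_le.1 (hc i)).2
    rw [imbalance]; linarith
  have hΔ' : ∀ t ∈ Set.Icc 0 T, imbalance (B t) ≤ 2 * δ ^ 2 * Real.exp (-(2 * κ * t)) := fun t ht =>
    (hΔ t ht).trans (mul_le_mul_of_nonneg_right hΔ0 (Real.exp_nonneg _))
  intro t ht
  have hs : size (B 0) - δ ≤ size (B t) := by
    have hd : ∀ t ∈ Set.Icc 0 T, HasDerivWithinAt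
        (fun t => 2 * δ ^ 2 / κ * Real.exp (-(2 * κ * t)) - size (B t)) _ (Ici 0) t := fun t ht =>
      ((((hasDerivWithinAt_id t _).const_mul (2 * κ)).neg.exp).const_mul (2 * δ ^ 2 / κ)).sub
        (hB.hasDeriv_size ht.1)
    have h := antitoneOn_Icc_of_hasDerivWithinAt hd (fun t ht => by
      have h1 := hΔ' t ht
      have : 2 * δ ^ 2 / κ * (Real.exp (-(2 * κ * t)) * -(2 * κ * 1)) =
          -2 * (2 * δ ^ 2 * Real.exp (-(2 * κ * t))) := by field_simp
      simp only [Pi.neg_apply, id]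
      rw [this]
      linarith) (left_mem_Icc.2 (ht.1.trans ht.2)) ht ht.1
    simp only [mul_zero, neg_zero, Real.exp_zero, mul_one] at h
    have h1 : 0 ≤ 2 * δ ^ 2 / κ * Real.exp (-(2 * κ * t)) := by positivity
    have h2 : 2 * δ ^ 2 / κ ≤ δ := by
      rw [div_le_iff₀ hκ]; nlinarith
    linarith
  have hA := hB.abs_defect_le ht.1 hr hc
  have hsq : N * imbalance (B t) ≤ N * (2 * δ * Real.exp (-(κ * t))) ^ 2 := by
    refine mul_le_mul_of_nonneg_left ((hΔ' t ht).trans ?_) (by linarith)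
    rw [mul_pow, ← Real.exp_nat_mul]
    have : ((2 : ℕ) : ℝ) * -(κ * t) = -(2 * κ * t) := by push_cast; ring
    rw [this]
    refine mul_le_mul_of_nonneg_right ?_ (Real.exp_nonneg _)
    nlinarith [sq_nonneg δ]
  have hsr : ∀ i, rowDefect (B t) i ^ 2 ≤ N * imbalance (B t) := fun i => by
    have h1 : rowDefect (B t) i ^ 2 ≤ ∑ i, rowDefect (B t) i ^ 2 :=
      single_le_sum (f := fun i => rowDefect (B t) i ^ 2) (fun i _ => sq_nonneg _) (mem_univ i)
    have h2 : (∑ i, rowDefect (B t) i ^ 2) / Fintype.card X ≤ imbalance (B t) :=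
      le_add_of_nonneg_right (by positivity)
    rw [div_le_iff₀ hm] at h2
    nlinarith [imbalance_nonneg (B t)]
  have hsc : ∀ j, colDefect (B t) j ^ 2 ≤ N * imbalance (B t) := fun j => by
    have h1 : colDefect (B t) j ^ 2 ≤ ∑ j, colDefect (B t) j ^ 2 :=
      single_le_sum (f := fun j => colDefect (B t) j ^ 2) (fun i _ => sq_nonneg _) (mem_univ j)
    have h2 : (∑ j, colDefect (B t) j ^ 2) / Fintype.card Y ≤ imbalance (B t) :=
      le_add_of_nonneg_left (by positivity)
    rw [div_le_iff₀ hn] at h2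
    nlinarith [imbalance_nonneg (B t)]
  exact ⟨hs,
    fun i => abs_le_mul_exp_of_sq_le hN (by linarith [hA.1 i]) ((hsr i).trans hsq),
    fun j => abs_le_mul_exp_of_sq_le hN (by linarith [hA.2 j]) ((hsc j).trans hsq)⟩

/-- The bootstrap runs on the integrated defects. Bounds by `-1 / 8` keep the entries above `B 0 /
2`, since `exp (-1 / 2) ≥ 1 / 2`; the resulting decay improves them to `-1 / 16`. -/
lemma defect_le_mul_exp_forall {t : ℝ} (ht : 0 ≤ t) : size (B 0) - δ ≤ size (B t) ∧
      (∀ i, |rowDefect (B t) i| ≤ 2 * δ * Real.exp (1 - κ * t / (Real.log N + 1))) ∧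
      ∀ j, |colDefect (B t) j| ≤ 2 * δ * Real.exp (1 - κ * t / (Real.log N + 1)) := by
  have hδ0 : 0 ≤ δ := (abs_nonneg _).trans (hr (Classical.arbitrary X))
  have hL : 1 ≤ Real.log N + 1 := by linarith [Real.log_nonneg hN]
  obtain ⟨p, q, hp0, hq0, hp, hq, hpq⟩ := hB.exists_potentials
  have hhalf : ∀ T, (∀ t ∈ Set.Icc 0 T, ∀ k, -(1 / 8) ≤ Sum.elim p q k t) →
      ∀ t ∈ Set.Icc 0 T, ∀ i j, B 0 i j / 2 ≤ B t i j := fun T h t ht i j => by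
    rw [hpq t ht.1, div_eq_mul_inv]
    refine mul_le_mul_of_nonneg_left ?_ (hB.nonneg 0 le_rfl i j)
    have h1 : -(1 / 8) ≤ p i t := h t ht (Sum.inl i)
    have h2 : -(1 / 8) ≤ q j t := h t ht (Sum.inr j)
    linarith [Real.add_one_le_exp (2 * (p i t + q j t))]
  have hall := forall_le_of_bootstrap (f := Sum.elim p q) (a := -(1 / 8)) (b := -(1 / 16))
    (by norm_num) (by
      rintro (i | j)
      · exact fun t ht => (hp t ht i).continuousWithinAt
      · exact fun t ht => (hq t ht j).continuousWithinAt)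
    (by
      rintro (i | j)
      · simp [hp0]
      · simp [hq0])
    (fun T hT h => by
      have hdec := hB.defect_le_mul_exp hP hκ hr hc hN hX hY hδ (hhalf T h)
      rintro (i | j)
      · exact neg_le_of_abs_deriv_le hκ hL hδ0 hδ (hp0 i) (fun t ht => hp t ht.1 i)
          (fun t ht => (hdec t ht).2.1 i) hT
      · exact neg_le_of_abs_deriv_le hκ hL hδ0 hδ (hq0 j) (fun t ht => hq t ht.1 j)
          (fun t ht => (hdec t ht).2.2 j) hT)
  exact hB.defect_le_mul_exp hP hκ hr hc hN hX hY hδ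
    (hhalf t fun τ hτ k => (by norm_num : (-(1 / 8) : ℝ) ≤ -(1 / 16)).trans (hall τ hτ.1 k)) t
    (right_mem_Icc.2 ht)

end IsScalingFlow

/-! ### Global existence of the flow -/

/-- A bounded, globally Lipschitz vector field has global integral curves. -/
theorem exists_forall_hasDerivAt_of_lipschitzWith {E : Type*} [NormedAddCommGroup E]
    [NormedSpace ℝ E] [CompleteSpace E] {v : E → E} {K L : NNReal} (hv : LipschitzWith K v)
    (hL : ∀ x, ‖v x‖ ≤ L) (x : E) : ∃ γ : ℝ → E, γ 0 = x ∧ ∀ t, HasDerivAt γ (v (γ t)) t := by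
  have hloc : ∀ T : {T : ℝ // 0 < T}, ∃ γ : ℝ → E, γ 0 = x ∧
      ∀ t ∈ Set.Ioo (-T.1) T.1, HasDerivAt γ (v (γ t)) t := by
    rintro ⟨T, hT⟩
    have hpl : IsPicardLindelof (fun _ => v) (tmin := -T) (tmax := T)
        ⟨0, by constructor <;> linarith⟩ x (L * T.toNNReal) 0 L K :=
      IsPicardLindelof.of_time_independent (fun x _ => hL x) hv.lipschitzOnWith (by
        simp [hT.le])
    obtain ⟨γ, h0, hγ⟩ := hpl.exists_eq_forall_mem_Icc_hasDerivWithinAt₀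
    exact ⟨γ, h0, fun t ht => (hγ t (Ioo_subset_Icc_self ht)).hasDerivAt (Icc_mem_nhds ht.1 ht.2)⟩
  choose γ h0 hγ using hloc
  have huniq : ∀ T T' : {T : ℝ // 0 < T}, T.1 ≤ T'.1 → EqOn (γ T) (γ T') (Set.Ioo (-T.1) T.1) :=
    fun T T' h => ODE_solution_unique_of_mem_Ioo (v := fun _ => v) (s := fun _ => Set.univ)
      (t₀ := 0)
      (fun _ _ => hv.lipschitzOnWith) ⟨by linarith [T.2], T.2⟩
      (fun t ht => ⟨hγ T t ht, Set.mem_univ _⟩)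
      (fun t ht => ⟨hγ T' t ⟨by linarith [ht.1], by linarith [ht.2]⟩, Set.mem_univ _⟩)
      (by rw [h0, h0])
  have hpos : ∀ t : ℝ, 0 < |t| + 1 := fun t => by positivity
  -- Glue the local solutions by using at time `t` the one on `(-(|t| + 1), |t| + 1)`; uniqueness
  -- makes them agree.
  refine ⟨fun t => γ ⟨|t| + 1, hpos t⟩ t, h0 _, fun t => ?_⟩
  have hmem : ∀ s : ℝ, s ∈ Set.Ioo (-(|s| + 1)) (|s| + 1) := fun s => by
    constructor <;> linarith [neg_abs_le s, le_abs_self s]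
  refine (hγ ⟨|t| + 1, hpos t⟩ t (hmem t)).congr_of_eventuallyEq ?_
  filter_upwards [Ioo_mem_nhds (hmem t).1 (hmem t).2] with s hs
  rcases le_total |s| |t| with h | h
  · exact huniq ⟨_, hpos s⟩ ⟨_, hpos t⟩ (by simpa using h) (hmem s)
  · exact (huniq ⟨_, hpos t⟩ ⟨_, hpos s⟩ (by simpa using h) hs).symm

lemma sum_mul_velocity (a : Matrix X Y ℝ) :
    ∑ i, ∑ j, a i j * velocity a i j = -imbalance (entrySq a) := by
  rw [← sum_defect_mul]
  refine sum_congr rfl fun i _ => sum_congr rfl fun j _ => ?_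
  simp only [velocity, entrySq, rowDefect, colDefect]
  ring

/-- The gradient flow exists for all times. -/
theorem exists_isGradientFlow {B₀ : Matrix X Y ℝ} (hB₀ : ∀ i j, 0 ≤ B₀ i j) :
    ∃ a, IsGradientFlow B₀ a := by
  have hs0 : 0 ≤ size B₀ := sum_nonneg fun i _ => sum_nonneg fun j _ => hB₀ i j
  set R : ℝ := size B₀ + 1 with hR
  have hR0 : 0 < R := by linarith
  -- The velocity is cubic, so it is cut off outside a ball. The size decreases along the cut-off
  -- flow too, since `χ ≥ 0`; hence the solution stays where `χ = 1`.
  let χ : ContDiffBump (0 : X → Y → ℝ) := ⟨R, R + 1, hR0, by linarith⟩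
  let v : (X → Y → ℝ) → X → Y → ℝ := velocity
  have hv : ContDiff ℝ 1 v := by
    refine contDiff_pi.2 fun i => contDiff_pi.2 fun j => ?_
    simp only [v, velocity, size, rowSum, colSum, entrySq]
    fun_prop
  have hw : ContDiff ℝ 1 fun a => χ a • v a := χ.contDiff.smul hv
  have hsupp : HasCompactSupport fun a => χ a • v a := χ.hasCompactSupport.smul_right
  obtain ⟨K, hK⟩ := hw.lipschitzWith_of_hasCompactSupport hsupp one_ne_zero
  obtain ⟨L, hL⟩ := hsupp.exists_bound_of_continuous hw.continuous
  obtain ⟨γ, h0, hγ⟩ := exists_forall_hasDerivAt_of_lipschitzWith (L := L.toNNReal) hK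
    (fun a => (hL a).trans (Real.le_coe_toNNReal L)) (fun i j => Real.sqrt (B₀ i j))
  have hγ' : ∀ t i j, HasDerivAt (fun t => γ t i j) (χ (γ t) * velocity (γ t) i j) t :=
    fun t i j => hasDerivAt_pi.1 (hasDerivAt_pi.1 (hγ t) i) j
  have hsq0 : entrySq (γ 0) = B₀ := by
    ext i j
    rw [h0]
    exact Real.sq_sqrt (hB₀ i j)
  have hsize : ∀ t, 0 ≤ t → size (entrySq (γ t)) ≤ size B₀ := fun t ht => by
    have hd : ∀ t, 0 ≤ t → HasDerivWithinAt (fun t => size (entrySq (γ t)))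
        (∑ i, ∑ j, ((2 : ℕ) : ℝ) * γ t i j ^ (2 - 1) * (χ (γ t) * velocity (γ t) i j)) (Ici 0) t :=
      fun t _ => HasDerivWithinAt.fun_sum fun i _ => HasDerivWithinAt.fun_sum fun j _ =>
        ((hγ' t i j).fun_pow 2).hasDerivWithinAt
    rw [← hsq0]
    refine le_of_hasDerivWithinAt_nonpos (f := fun t => size (entrySq (γ t))) ht hd fun t _ => ?_
    have : ∑ i, ∑ j, ((2 : ℕ) : ℝ) * γ t i j ^ (2 - 1) * (χ (γ t) * velocity (γ t) i j) =
        -(2 * χ (γ t) * imbalance (entrySq (γ t))) := by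
      have key : ∑ i, ∑ j, γ t i j * velocity (γ t) i j = -imbalance (entrySq (γ t)) :=
        sum_mul_velocity _
      rw [← mul_neg, ← key, mul_sum]
      refine sum_congr rfl fun i _ => ?_
      rw [mul_sum]
      refine sum_congr rfl fun j _ => ?_
      push_cast
      ring
    rw [this, neg_nonpos]
    exact mul_nonneg (mul_nonneg zero_le_two χ.nonneg) (imbalance_nonneg _)
  have hχ : ∀ t, 0 ≤ t → χ (γ t) = 1 := fun t ht => by
    refine χ.one_of_mem_closedBall (mem_closedBall_zero_iff.2 ?_)
    refine (pi_norm_le_iff_of_nonneg hR0.le).2 fun i =>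
      (pi_norm_le_iff_of_nonneg hR0.le).2 fun j => ?_
    have h1 : γ t i j ^ 2 ≤ size (entrySq (γ t)) :=
      (single_le_sum (f := fun j => γ t i j ^ 2) (fun j _ => sq_nonneg _) (mem_univ j)).trans
        (single_le_sum (f := fun i => ∑ j, γ t i j ^ 2)
          (fun i _ => sum_nonneg fun j _ => sq_nonneg _) (mem_univ i))
    have h2 := hsize t ht
    exact abs_le_of_sq_le_sq (by nlinarith) hR0.le
  refine ⟨γ, fun i j => by rw [h0], fun t ht i j => ?_⟩
  have := (hγ' t i j).hasDerivWithinAt (s := Ici 0)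
  rwa [hχ t ht, one_mul] at this

/-! ### From small defects to balance and matchings -/

lemma isNearlyDoublyBalanced_of_defect_le [Nonempty X] [Nonempty Y] {B : Matrix X Y ℝ} {η : ℝ}
    (h0 : ∀ i j, 0 ≤ B i j) (hr : ∀ i, |rowDefect B i| ≤ η * size B)
    (hc : ∀ j, |colDefect B j| ≤ η * size B) : IsNearlyDoublyBalanced η B := by
  have hm : (0 : ℝ) < Fintype.card X := by exact_mod_cast Fintype.card_pos
  have hn : (0 : ℝ) < Fintype.card Y := by exact_mod_cast Fintype.card_pos
  have hr' := fun i => abs_le.1 (hr i)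
  have hc' := fun j => abs_le.1 (hc j)
  simp only [rowDefect, colDefect] at hr' hc'
  refine ⟨h0, fun i => ?_, fun i => ?_, fun j => ?_, fun j => ?_⟩
  · rw [← mul_div_assoc, div_le_iff₀ hm]; linarith [hr' i]
  · rw [← mul_div_assoc, le_div_iff₀ hm]; linarith [hr' i]
  · rw [← mul_div_assoc, div_le_iff₀ hn]; linarith [hc' j]
  · rw [← mul_div_assoc, le_div_iff₀ hn]; linarith [hc' j]

lemma abs_mul_div_sub_one_le {s c x η : ℝ} (hs : 0 < s) (hc : 0 < c)
    (h1 : (1 - η) * (s / c) ≤ x) (h2 : x ≤ (1 + η) * (s / c)) : |c / s * x - 1| ≤ η := by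
  have e : c / s * (s / c) = 1 := by field_simp
  have h3 := mul_le_mul_of_nonneg_left h1 (div_pos hc hs).le
  have h4 := mul_le_mul_of_nonneg_left h2 (div_pos hc hs).le
  rw [mul_left_comm, e, mul_one] at h3 h4
  exact abs_le.2 ⟨by linarith, by linarith⟩

lemma IsNearlyDoublyBalanced.isNearlyPerfectFractionalMatching [Nonempty X] [Nonempty Y]
    {G : SimpleGraph (X ⊕ Y)} [DecidableRel G.Adj] {B : Matrix X Y ℝ} {η : ℝ}
    (hB : IsNearlyDoublyBalanced η B) (hXY : Fintype.card X = Fintype.card Y)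
    (hs : 0 < size B) (hG : ∀ i j, ¬G.Adj (Sum.inl i) (Sum.inr j) → B i j = 0) :
    IsNearlyPerfectFractionalMatching G η (((Fintype.card X : ℝ) / size B) • B) := by
  have hm : (0 : ℝ) < Fintype.card X := by exact_mod_cast Fintype.card_pos
  refine ⟨fun i j => mul_nonneg (div_pos hm hs).le (hB.nonneg i j),
    fun i j h => by simp [hG i j h], fun i => ?_, fun j => ?_⟩
  · have := abs_mul_div_sub_one_le hs hm (hB.row_lower i) (hB.row_upper i)
    rw [rowSum, mul_sum] at this
    exact this
  · have h1 := hB.col_lower j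
    have h2 := hB.col_upper j
    rw [← hXY] at h1 h2
    have := abs_mul_div_sub_one_le hs hm h1 h2
    rw [colSum, mul_sum] at this
    exact this

/-! ### Bipartite graphs and their Poincaré inequality -/

section Bipartite

lemma not_adj_inl_inl {X Y : Type*} {G : SimpleGraph (X ⊕ Y)}
    (hG : G ≤ completeBipartiteGraph X Y) (i i' : X) :
    ¬G.Adj (Sum.inl i) (Sum.inl i') := fun h => by simpa using hG h

lemma not_adj_inr_inr {X Y : Type*} {G : SimpleGraph (X ⊕ Y)}
    (hG : G ≤ completeBipartiteGraph X Y) (j j' : Y) :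
    ¬G.Adj (Sum.inr j) (Sum.inr j') := fun h => by simpa using hG h

variable {G : SimpleGraph (X ⊕ Y)} [DecidableRel G.Adj]

lemma sum_adjMatrix_mul (hG : G ≤ completeBipartiteGraph X Y) (f : X ⊕ Y → X ⊕ Y → ℝ)
    (hf : ∀ x y, f x y = f y x) : ∑ x, ∑ y, G.adjMatrix ℝ x y * f x y =
      2 * ∑ i, ∑ j, biadjacency G i j * f (Sum.inl i) (Sum.inr j) := by
  simp only [Fintype.sum_sum_type, SimpleGraph.adjMatrix_apply, not_adj_inl_inl hG,
    not_adj_inr_inr hG, if_false, zero_mul, sum_const_zero, zero_add, add_zero, biadjacency]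
  rw [sum_comm (s := (univ : Finset Y)), two_mul]
  refine congrArg₂ _ rfl (sum_congr rfl fun i _ => sum_congr rfl fun j _ => ?_)
  simp only [hf (Sum.inr j), G.adj_comm (Sum.inr j)]

lemma sum_adjMatrix_apply [DecidableEq X] [DecidableEq Y] (x : X ⊕ Y) :
    ∑ y, G.adjMatrix ℝ x y = G.degree x := by
  simp [SimpleGraph.adjMatrix_apply, ← SimpleGraph.card_neighborFinset_eq_degree,
    SimpleGraph.neighborFinset_eq_filter]

lemma rowSum_biadjacency [DecidableEq X] [DecidableEq Y] (hG : G ≤ completeBipartiteGraph X Y)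
    (i : X) : rowSum (biadjacency G) i = G.degree (Sum.inl i) := by
  rw [← sum_adjMatrix_apply, Fintype.sum_sum_type]
  simp only [SimpleGraph.adjMatrix_apply, not_adj_inl_inl hG, rowSum, biadjacency, if_false,
    sum_const_zero, zero_add]

lemma colSum_biadjacency [DecidableEq X] [DecidableEq Y] (hG : G ≤ completeBipartiteGraph X Y)
    (j : Y) : colSum (biadjacency G) j = G.degree (Sum.inr j) := by
  rw [← sum_adjMatrix_apply, Fintype.sum_sum_type]
  simp only [SimpleGraph.adjMatrix_apply, not_adj_inr_inr hG, colSum, biadjacency, if_false,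
    sum_const_zero, add_zero, G.adj_comm (Sum.inr j)]

lemma size_biadjacency [DecidableEq X] [DecidableEq Y] (hG : G ≤ completeBipartiteGraph X Y) :
    size (biadjacency G) = #G.edgeFinset := by
  have h1 : (∑ x, (G.degree x : ℝ)) = 2 * #G.edgeFinset := by
    exact_mod_cast G.sum_degrees_eq_twice_card_edges
  have h2 := sum_adjMatrix_mul hG (fun _ _ => 1) fun _ _ => rfl
  simp only [mul_one, sum_adjMatrix_apply, h1] at h2
  exact (mul_left_cancel₀ two_ne_zero h2).symm

/-- The Poincaré inequality which Cheeger's inequality gives for a nearly regular bipartite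
graph. -/
lemma conductance_poincare [DecidableEq X] [DecidableEq Y] (hG : G ≤ completeBipartiteGraph X Y)
    {d : ℝ} (hd0 : 0 ≤ d) (hd : ∀ x, d ≤ G.degree x) (f : X → ℝ) (g : Y → ℝ)
    (hf : ∑ i, f i = 0) (hg : ∑ j, g j = 0) :
    conductance (G.adjMatrix ℝ) ^ 2 * d * (∑ i, f i ^ 2 + ∑ j, g j ^ 2) ≤
      2 * ∑ i, ∑ j, biadjacency G i j * (f i + g j) ^ 2 := by
  -- The sign flip on `Y` turns the differences in Cheeger's inequality into the sums `f i + g j`.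
  have h := conductance_sq_mul_sum_sq_le (w := G.adjMatrix ℝ)
    (fun x y => by rw [SimpleGraph.adjMatrix_apply]; split_ifs <;> simp)
    (fun x y => by simp only [SimpleGraph.adjMatrix_apply, G.adj_comm])
    hd0 (fun x => (hd x).trans_eq (sum_adjMatrix_apply x).symm) (Sum.elim f fun j => -g j)
    (by simp [Fintype.sum_sum_type, hf, hg])
  rw [sum_adjMatrix_mul hG _ fun x y => by ring] at h
  simpa [Fintype.sum_sum_type] using h

end Bipartite

/-! ### Scalings and the final estimate -/

lemma biadjacency_nonneg {X Y : Type*} {G : SimpleGraph (X ⊕ Y)} [DecidableRel G.Adj]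
    (i : X) (j : Y) : 0 ≤ biadjacency G i j := by
  unfold biadjacency; split_ifs <;> simp

lemma IsScalingOf.eq_zero {X Y : Type*} {B A : Matrix X Y ℝ} (h : IsScalingOf B A) {i : X} {j : Y}
    (hA : A i j = 0) : B i j = 0 := by
  obtain ⟨l, r, -, -, h⟩ := h
  rw [h, hA, mul_zero, zero_mul]

lemma size_smul (c : ℝ) (B : Matrix X Y ℝ) : size (c • B) = c * size B := by
  simp [size, mul_sum]

lemma rowDefect_smul (c : ℝ) (B : Matrix X Y ℝ) (i : X) :
    rowDefect (c • B) i = c * rowDefect B i := by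
  simp only [rowDefect, size_smul, rowSum, Matrix.smul_apply, smul_eq_mul, ← mul_sum]
  ring

lemma colDefect_smul (c : ℝ) (B : Matrix X Y ℝ) (j : Y) :
    colDefect (c • B) j = c * colDefect B j := by
  simp only [colDefect, size_smul, colSum, Matrix.smul_apply, smul_eq_mul, ← mul_sum]
  ring

lemma abs_sub_mul_le {E N ε x : ℝ} (hN : 0 < N) (h1 : (1 - ε) * (E / N) ≤ x)
    (h2 : x ≤ (1 + ε) * (E / N)) : |E - N * x| ≤ ε * E := by
  rw [← mul_div_assoc, div_le_iff₀ hN] at h1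
  rw [← mul_div_assoc, le_div_iff₀ hN] at h2
  exact abs_le.2 ⟨by linarith, by linarith⟩

lemma IsScalingFlow.isScalingOf {B : ℝ → Matrix X Y ℝ} (hB : IsScalingFlow B)
    {A : Matrix X Y ℝ} {c : ℝ} (hc : 0 < c) (h0 : B 0 = c • A) {t : ℝ} (ht : 0 ≤ t) : IsScalingOf (B t) A := by
  obtain ⟨p, q, -, -, -, -, h⟩ := hB.exists_potentials
  refine ⟨fun i => c * Real.exp (2 * p i t), fun j => Real.exp (2 * q j t),
    fun i => by positivity, fun j => by positivity, fun i j => ?_⟩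
  rw [h t ht, h0, mul_add, Real.exp_add, Matrix.smul_apply, smul_eq_mul]
  ring

lemma IsScalingOf.size_pos {B A : Matrix X Y ℝ} (h : IsScalingOf B A) (hA0 : ∀ i j, 0 ≤ A i j)
    (hA : 0 < size A) : 0 < size B := by
  obtain ⟨l, r, hl, hr, h⟩ := h
  have hB : ∀ i j, 0 ≤ B i j := fun i j => by
    rw [h]; exact mul_nonneg (mul_nonneg (hl i).le (hA0 i j)) (hr j).le
  obtain ⟨i, -, hi⟩ := exists_lt_of_sum_lt (s := univ) (f := fun _ : X => (0 : ℝ))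
    (g := fun i => ∑ j, A i j) (by rw [sum_const_zero]; exact hA)
  obtain ⟨j, -, hj⟩ := exists_lt_of_sum_lt (s := univ) (f := fun _ : Y => (0 : ℝ))
    (g := fun j => A i j) (by simpa using hi)
  refine sum_pos' (fun i _ => sum_nonneg fun j _ => hB i j) ⟨i, mem_univ i, ?_⟩
  refine sum_pos' (fun j _ => hB i j) ⟨j, mem_univ j, ?_⟩
  rw [h]
  exact mul_pos (mul_pos (hl i) hj) (hr j)

lemma defect_eq_zero_of_imbalance_eq_zero [Nonempty X] [Nonempty Y] {B : Matrix X Y ℝ}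
    (h : imbalance B = 0) : (∀ i, rowDefect B i = 0) ∧ ∀ j, colDefect B j = 0 := by
  have hm : (0 : ℝ) < Fintype.card X := by exact_mod_cast Fintype.card_pos
  have hn : (0 : ℝ) < Fintype.card Y := by exact_mod_cast Fintype.card_pos
  have z := (add_eq_zero_iff_of_nonneg (by positivity) (by positivity)).1 h
  have z1 := (sum_eq_zero_iff_of_nonneg fun i _ => sq_nonneg _).1
    ((div_eq_zero_iff.1 z.1).resolve_right hm.ne')
  have z2 := (sum_eq_zero_iff_of_nonneg fun i _ => sq_nonneg _).1
    ((div_eq_zero_iff.1 z.2).resolve_right hn.ne')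
  exact ⟨fun i => pow_eq_zero_iff two_ne_zero |>.1 (z1 i (mem_univ i)),
    fun j => pow_eq_zero_iff two_ne_zero |>.1 (z2 j (mem_univ j))⟩

/-- The exponential bound on the defects reaches the relative accuracy `η` in the time claimed. -/
lemma exp_defect_bound_le {φ ε s₀ s η t N : ℝ} (hN : 2 ≤ N) (hφ0 : 0 < φ) (hφ1 : φ ≤ 1)
    (hs₀ : 0 < s₀) (hε0 : 0 ≤ ε) (hε : 100 * (ε * s₀ * (Real.log N + 1)) ≤ φ ^ 2 / 4 * s₀)
    (hs : s₀ - ε * s₀ ≤ s) (hη : 0 < η) (hη1 : η ≤ 1)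
    (ht : 20 * Real.log N * Real.log (1 / η) ≤ s₀ * φ ^ 2 * t) :
    2 * (ε * s₀) * Real.exp (1 - φ ^ 2 / 4 * s₀ * t / (Real.log N + 1)) ≤ η * s := by
  have hl : 0.69 ≤ Real.log N :=
    (by linarith [Real.log_two_gt_d9] : 0.69 ≤ Real.log 2).trans (Real.log_le_log two_pos hN)
  set L := Real.log N + 1 with hL
  have hL1 : 0 < L := by linarith
  have hlη : 0 ≤ Real.log (1 / η) := Real.log_nonneg (one_le_one_div hη hη1)
  have hε1 : ε ≤ 1 / 100 := by
    have h1 : 100 * (ε * L) ≤ φ ^ 2 / 4 := le_of_mul_le_mul_right (by linarith) hs₀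
    have h2 : φ ^ 2 ≤ 1 := pow_le_one₀ hφ0.le hφ1
    nlinarith [mul_nonneg hε0 (by linarith : 0 ≤ L - 1)]
  -- The constant 20 is `4 * 5`: the 4 comes from the rate `φ ^ 2 s₀ / 4`, the 5 from `log N + 1 ≤ 5
  -- log N` for `N ≥ 2`.
  have hexp : Real.log (1 / η) ≤ φ ^ 2 / 4 * s₀ * t / L := by
    rw [le_div_iff₀ hL1]
    nlinarith [mul_nonneg hlη (by linarith : 0 ≤ 5 * Real.log N - L)]
  have h1 : Real.exp (1 - φ ^ 2 / 4 * s₀ * t / L) ≤ Real.exp 1 * η := by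
    calc Real.exp (1 - φ ^ 2 / 4 * s₀ * t / L) ≤ Real.exp (1 + Real.log η) := by
          refine Real.exp_le_exp.2 ?_
          rw [one_div, Real.log_inv] at hexp
          linarith
      _ = Real.exp 1 * η := by rw [Real.exp_add, Real.exp_log hη]
  have h2 : s₀ / 2 ≤ s := by nlinarith
  have he := Real.exp_one_lt_d9
  calc 2 * (ε * s₀) * Real.exp (1 - φ ^ 2 / 4 * s₀ * t / L)
      ≤ 2 * (ε * s₀) * (Real.exp 1 * η) := mul_le_mul_of_nonneg_left h1 (by positivity)
    _ = η * (s₀ * (2 * (ε * Real.exp 1))) := by ring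
    _ ≤ η * (s₀ * (2 * (1 / 100 * 3))) := by gcongr; linarith
    _ ≤ η * s := by gcongr; linarith

/-- The defects of the gradient flow of a nearly regular bipartite graph. -/
theorem defect_le_of_conductance [DecidableEq X] [DecidableEq Y] {G : SimpleGraph (X ⊕ Y)}
    [DecidableRel G.Adj] {ε : ℝ} (hG : G ≤ completeBipartiteGraph X Y)
    (hXY : Fintype.card X = Fintype.card Y) (hE : G.edgeFinset.Nonempty)
    (hdeg : ∀ v, (1 - ε) * ((#G.edgeFinset : ℝ) / Fintype.card X) ≤ G.degree v ∧
      (G.degree v : ℝ) ≤ (1 + ε) * ((#G.edgeFinset : ℝ) / Fintype.card X))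
    (hφ : 2000 * ε * Real.log (Fintype.card X) ≤ conductance (G.adjMatrix ℝ) ^ 4)
    {s₀ : ℝ} (hs₀ : 0 < s₀) {B : ℝ → Matrix X Y ℝ} (hB : IsScalingFlow B)
    (hB0 : B 0 = (s₀ / #G.edgeFinset) • biadjacency G) [Nonempty X] [Nonempty Y] {η t : ℝ}
    (hη : 0 < η) (hη1 : η ≤ 1) (ht : 0 ≤ t) (hlog : 20 * Real.log (Fintype.card X) *
      Real.log (1 / η) ≤ s₀ * conductance (G.adjMatrix ℝ) ^ 2 * t)
    (hpos : 0 < size (B t)) :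
    (∀ i, |rowDefect (B t) i| ≤ η * size (B t)) ∧ ∀ j, |colDefect (B t) j| ≤ η * size (B t) := by
  have hm : (0 : ℝ) < Fintype.card X := by exact_mod_cast Fintype.card_pos
  have hE0 : (0 : ℝ) < #G.edgeFinset := by exact_mod_cast hE.card_pos
  set c : ℝ := s₀ / #G.edgeFinset with hc
  have hc0 : 0 < c := div_pos hs₀ hE0
  have hcE : c * #G.edgeFinset = s₀ := div_mul_cancel₀ _ hE0.ne'
  have hsize : size (B 0) = s₀ := by rw [hB0, size_smul, size_biadjacency hG, hcE]
  have hr : ∀ i, |rowDefect (B 0) i| ≤ ε * s₀ := fun i => by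
    rw [hB0, rowDefect_smul, abs_mul, abs_of_pos hc0, rowDefect, size_biadjacency hG,
      rowSum_biadjacency hG, ← hcE, mul_left_comm]
    exact mul_le_mul_of_nonneg_left (abs_sub_mul_le hm (hdeg _).1 (hdeg _).2) hc0.le
  have hcol : ∀ j, |colDefect (B 0) j| ≤ ε * s₀ := fun j => by
    rw [hB0, colDefect_smul, abs_mul, abs_of_pos hc0, colDefect, size_biadjacency hG,
      colSum_biadjacency hG, ← hcE, ← hXY, mul_left_comm]
    exact mul_le_mul_of_nonneg_left (abs_sub_mul_le hm (hdeg _).1 (hdeg _).2) hc0.le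
  have hε0 : 0 ≤ ε := by
    have := (abs_nonneg _).trans (hr (Classical.arbitrary X))
    exact nonneg_of_mul_nonneg_left this hs₀
  -- A balanced input stays balanced. This disposes of the degenerate cases: otherwise `|X| ≥ 2` and
  -- `ε > 0`, and the hypothesis on the conductance then forces `φ > 0`.
  by_cases hbal : imbalance (B 0) = 0
  · obtain ⟨h1, h2⟩ := defect_eq_zero_of_imbalance_eq_zero (hB.imbalance_eq_zero hbal ht)
    have : 0 ≤ η * size (B t) := by positivity
    exact ⟨fun i => by rwa [h1, abs_zero], fun j => by rwa [h2, abs_zero]⟩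
  have hw : ∀ x y, 0 ≤ G.adjMatrix ℝ x y := fun x y => by
    rw [SimpleGraph.adjMatrix_apply]; split_ifs <;> simp
  set φ := conductance (G.adjMatrix ℝ)
  have hφ0' : 0 ≤ φ := conductance_nonneg hw
  have hφ1 : φ ≤ 1 := conductance_le_one hw
  have hN : (2 : ℝ) ≤ Fintype.card X := by
    by_contra! hlt
    have h1 : Fintype.card X = 1 := by
      have : Fintype.card X < 2 := by exact_mod_cast hlt
      have := Fintype.card_pos (α := X)
      omega
    have h2 : Fintype.card Y = 1 := hXY ▸ h1
    have : Subsingleton X := Fintype.card_le_one_iff_subsingleton.1 h1.le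
    have : Subsingleton Y := Fintype.card_le_one_iff_subsingleton.1 h2.le
    have h3 := sum_rowDefect (B 0)
    have h4 := sum_colDefect (B 0)
    obtain ⟨x⟩ := ‹Nonempty X›
    obtain ⟨y⟩ := ‹Nonempty Y›
    rw [Fintype.sum_subsingleton _ x] at h3
    rw [Fintype.sum_subsingleton _ y] at h4
    refine hbal ?_
    rw [imbalance, Fintype.sum_subsingleton _ x, Fintype.sum_subsingleton _ y, h3, h4]
    simp
  have hεpos : 0 < ε := by
    refine hε0.lt_of_ne fun h => hbal ?_
    rw [← h, zero_mul] at hr hcol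
    have h1 : ∀ i, rowDefect (B 0) i = 0 := fun i => abs_nonpos_iff.1 (hr i)
    have h2 : ∀ j, colDefect (B 0) j = 0 := fun j => abs_nonpos_iff.1 (hcol j)
    simp [imbalance, h1, h2]
  have hl : 0.69 ≤ Real.log (Fintype.card X) :=
    (by linarith [Real.log_two_gt_d9] : 0.69 ≤ Real.log 2).trans (Real.log_le_log two_pos hN)
  have hφ0 : 0 < φ := by
    refine hφ0'.lt_of_ne fun h => ?_
    rw [← h, zero_pow four_ne_zero] at hφ
    have : 0 < 2000 * ε * Real.log (Fintype.card X) := by positivity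
    linarith
  have hφ2 : φ ^ 2 ≤ 1 := pow_le_one₀ hφ0' hφ1
  have hφ4 : φ ^ 4 ≤ φ ^ 2 := pow_le_pow_of_le_one hφ0' hφ1 (by norm_num)
  -- Since `log N ≥ 0.69`, `400 (log N + 1) ≤ 2000 log N`; the hypothesis enters through `φ ^ 4 ≤ φ
  -- ^ 2`.
  have hεL : 100 * (ε * (Real.log (Fintype.card X) + 1)) ≤ φ ^ 2 / 4 := by
    nlinarith [mul_le_mul_of_nonneg_left hl hε0]
  have hε2 : ε ≤ 1 / 2 := by nlinarith
  -- Degrees are at least `(1 - ε) |E| / |X|`, and `(1 - ε) / 2 ≥ 1 / 4`; this is the 4 in `κ`.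
  have hP : ∀ (f : X → ℝ) (g : Y → ℝ), ∑ i, f i = 0 → ∑ j, g j = 0 →
      φ ^ 2 / 4 * s₀ * ((∑ i, f i ^ 2) / Fintype.card X + (∑ j, g j ^ 2) / Fintype.card Y) ≤
        ∑ i, ∑ j, B 0 i j * (f i + g j) ^ 2 := fun f g hf hg => by
    have h1 := conductance_poincare hG
      (mul_nonneg (by linarith : 0 ≤ 1 - ε) (div_pos hE0 hm).le)
      (fun v => (hdeg v).1) f g hf hg
    have h2 : ∑ i, ∑ j, B 0 i j * (f i + g j) ^ 2 =
        c * ∑ i, ∑ j, biadjacency G i j * (f i + g j) ^ 2 := by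
      simp only [hB0, Matrix.smul_apply, smul_eq_mul, mul_sum, mul_assoc]
    have h3 : 0 ≤ φ ^ 2 * s₀ * ((∑ i, f i ^ 2 + ∑ j, g j ^ 2) / Fintype.card X) := by positivity
    have h4 := mul_le_mul_of_nonneg_left h1 hc0.le
    have h5 : c * (φ ^ 2 * ((1 - ε) * ((#G.edgeFinset : ℝ) / Fintype.card X)) *
        (∑ i, f i ^ 2 + ∑ j, g j ^ 2)) =
        (1 - ε) * (φ ^ 2 * s₀ * ((∑ i, f i ^ 2 + ∑ j, g j ^ 2) / Fintype.card X)) := by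
      rw [← hcE]; ring
    rw [h2, ← hXY, ← add_div]
    nlinarith
  have hδ : 100 * (ε * s₀ * (Real.log (Fintype.card X) + 1)) ≤ φ ^ 2 / 4 * s₀ := by
    nlinarith [mul_le_mul_of_nonneg_right hεL hs₀.le]
  obtain ⟨h1, h2, h3⟩ := hB.defect_le_mul_exp_forall hP (by positivity) hr hcol (by linarith)
    le_rfl (by rw [hXY]) hδ ht
  have hfin := exp_defect_bound_le hN hφ0 hφ1 hs₀ hε0 hδ (hsize ▸ h1) hη hη1 hlog
  exact ⟨fun i => (h2 i).trans hfin, fun j => (h3 j).trans hfin⟩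

end MatrixScaling

end

theorem corollaryc :
    ∃ C : ℝ, 0 < C ∧ ∃ K : ℝ, 0 < K ∧
      ∀ (X Y : Type*) [Fintype X] [Fintype Y] [DecidableEq X] [DecidableEq Y]
        (G : SimpleGraph (X ⊕ Y)) [DecidableRel G.Adj] (ε : ℝ),
        G ≤ completeBipartiteGraph X Y →
        Fintype.card X = Fintype.card Y →
        G.edgeFinset.Nonempty →
        (∀ v, (1 - ε) * ((G.edgeFinset.card : ℝ) / Fintype.card X) ≤ G.degree v ∧
          (G.degree v : ℝ) ≤ (1 + ε) * ((G.edgeFinset.card : ℝ) / Fintype.card X)) →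
        C * ε * Real.log (Fintype.card X) ≤ MatrixScaling.conductance (G.adjMatrix ℝ) ^ 4 →
        ∀ s₀ : ℝ, 0 < s₀ →
          (∃ a : ℝ → Matrix X Y ℝ, MatrixScaling.IsGradientFlow
            ((s₀ / G.edgeFinset.card) • MatrixScaling.biadjacency G) a) ∧
          ∀ a : ℝ → Matrix X Y ℝ,
            MatrixScaling.IsGradientFlow
              ((s₀ / G.edgeFinset.card) • MatrixScaling.biadjacency G) a →
            ∀ η : ℝ, 0 < η → η ≤ 1 → ∀ t : ℝ, 0 ≤ t →
              K * Real.log (Fintype.card X) * Real.log (1 / η) ≤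
                s₀ * MatrixScaling.conductance (G.adjMatrix ℝ) ^ 2 * t →
              MatrixScaling.IsScalingOf (MatrixScaling.entrySq (a t))
                  (MatrixScaling.biadjacency G) ∧
                MatrixScaling.IsNearlyDoublyBalanced η (MatrixScaling.entrySq (a t)) ∧
                MatrixScaling.IsNearlyPerfectFractionalMatching G η
                  (((Fintype.card X : ℝ) / MatrixScaling.size (MatrixScaling.entrySq (a t))) •
                    MatrixScaling.entrySq (a t)) := by
  refine ⟨2000, by norm_num, 20, by norm_num, ?_⟩
  intro X Y _ _ _ _ G _ ε hG hXY hE hdeg hφ s₀ hs₀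
  have hE0 : (0 : ℝ) < G.edgeFinset.card := by exact_mod_cast hE.card_pos
  have hc : 0 < s₀ / G.edgeFinset.card := div_pos hs₀ hE0
  have hB₀ : ∀ i j, 0 ≤ ((s₀ / G.edgeFinset.card) • MatrixScaling.biadjacency G) i j := fun i j =>
    mul_nonneg hc.le (MatrixScaling.biadjacency_nonneg i j)
  have hA : 0 < MatrixScaling.size (MatrixScaling.biadjacency G) := by
    rwa [MatrixScaling.size_biadjacency hG]
  have hX : Nonempty X := by
    by_contra h
    rw [not_nonempty_iff] at h
    simp [MatrixScaling.size] at hA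
  have hY : Nonempty Y := Fintype.card_pos_iff.1 (hXY ▸ Fintype.card_pos)
  refine ⟨MatrixScaling.exists_isGradientFlow hB₀, fun a ha η hη hη1 t ht hlog => ?_⟩
  have h0 : MatrixScaling.entrySq (a 0) =
      (s₀ / G.edgeFinset.card) • MatrixScaling.biadjacency G := by
    ext i j
    rw [MatrixScaling.entrySq, ha.init, Real.sq_sqrt (hB₀ i j)]
  have hB := ha.isScalingFlow
  have hscal := hB.isScalingOf hc h0 ht
  have hpos := hscal.size_pos MatrixScaling.biadjacency_nonneg hA
  obtain ⟨hr, hcol⟩ := MatrixScaling.defect_le_of_conductance hG hXY hE hdeg hφ hs₀ hB h0 hη hη1 ht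
    hlog hpos
  have hbal := MatrixScaling.isNearlyDoublyBalanced_of_defect_le (hB.nonneg t ht) hr hcol
  exact ⟨hscal, hbal, hbal.isNearlyPerfectFractionalMatching hXY hpos fun i j hij =>
    hscal.eq_zero (if_neg hij)⟩
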